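/- We test functions $f:\{0,1\}^n\to\{0,1\}$ for unateness (for each coordinate $i$, $f$ is non-decreasing in $x_i$ or non-increasing in $x_i$). For $f\not\equiv 0$ put $$\mathsf{reldist}(f,\mathrm{unate})=\min_{g\ \mathrm{unate}}\frac{|f^{-1}(1)\,\triangle\,g^{-1}(1)|}{|f^{-1}(1)|}.$$ A non-adaptive relative-error algorithm is randomized; it first draws independent uniform samples from $f^{-1}(1)$, then makes one parallel round of black-box queries to $f$ (the query points may depend on the samples and on the internal randomness, but not on answers to other queries), and then answers "yes" or "no". Its query complexity is the worst-case total number of samples and black-box queries. **Theorem.** For every constant $\alpha_0<1$ there are constants $\varepsilon_0>0$, $C\ge 1$, $c>0$ and $k,N_0\in\mathbb N$, depending only on $\alpha_0$, such that the following holds for all $n$ and all integers $N\ge N_0$ with $N\le 2^{\alpha_0 n}$. Let $T$ be any non-adaptive relative-error algorithm (with two-sided error; it may depend on $n$ and $N$) such that, for every $f:\{0,1\}^n\to\{0,1\}$ with $f\not\equiv0$ and $N/C\le |f^{-1}(1)|\le C N$, it answers "yes" with probability at least $2/3$ if $f$ is unate, and answers "no" with probability at least $2/3$ if $\mathsf{reldist}(f,\mathrm{unate})\ge\varepsilon_0$.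 If $T$ always makes at most $q$ samples and queries in total, then $$q\ \ge\ c\,\frac{\log N}{(\log\log N)^{k}}.$$ In other words, $\tilde\Omega(\log N)$ samples and queries are necessary, even if $|f^{-1}(1)|$ is known up to a constant factor. -/

import Mathlib

namespace RelativeError

/-- The Boolean hypercube `{0,1}^n`. -/
abbrev Cube (n : ℕ) : Type := Fin n → Bool

/-- The satisfying assignments `f⁻¹(1)`. -/
def satSet {n : ℕ} (f : Cube n → Bool) : Finset (Cube n) :=
  Finset.univ.filter fun x => f x = true

/-- `f` is `1`-monotone in direction `i`. -/
def OneMonotoneIn {n : ℕ} (f : Cube n → Bool) (i : Fin n) : Prop :=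
  ∀ x : Cube n, f (Function.update x i false) ≤ f (Function.update x i true)

/-- `f` is `0`-monotone in direction `i`. -/
def ZeroMonotoneIn {n : ℕ} (f : Cube n → Bool) (i : Fin n) : Prop :=
  ∀ x : Cube n, f (Function.update x i true) ≤ f (Function.update x i false)

/-- The class of unate functions on `{0,1}^n`. -/
def unate (n : ℕ) : Set (Cube n → Bool) :=
  {f | ∀ i : Fin n, OneMonotoneIn f i ∨ ZeroMonotoneIn f i}

/-- `reldist(f, g) = |f⁻¹(1) ∆ g⁻¹(1)| / |f⁻¹(1)|`
(only meaningful, and only used, for `f` not identically `0`). -/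
noncomputable def relDist {n : ℕ} (f g : Cube n → Bool) : ℝ :=
  ((symmDiff (satSet f) (satSet g)).card : ℝ) / ((satSet f).card : ℝ)

/-- `reldist(f, 𝒞) = min_{g ∈ 𝒞} reldist(f, g)`; for a nonempty class the infimum is over a
finite nonempty set of reals, hence a minimum. -/
noncomputable def relDistTo {n : ℕ} (f : Cube n → Bool) (𝒞 : Set (Cube n → Bool)) : ℝ :=
  sInf (relDist f '' 𝒞)

/-- A deterministic non-adaptive relative-error testing algorithm on `{0,1}^n`. It first calls the
sampling oracle some number of times (`sample next` asks for one sample `x` and goes on with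
`next x`, so that the decision to stop sampling may depend on the samples received). Then it
makes a single parallel round of black-box queries (`query pts accept` asks for the values of `f`
at all points of the list `pts` at once), and answers `accept b` (`true` is "yes", `false` is
"no"), where `b` is the list of values received. The points and the final decision may depend on
the samples, but no query point depends on the answer to another query. -/
inductive NonadaptiveAlg (n : ℕ) : Type
  | sample (next : Cube n → NonadaptiveAlg n) : NonadaptiveAlg n
  | query (pts : List (Cube n)) (accept : List Bool → Bool) : NonadaptiveAlg n

namespace NonadaptiveAlg

/-- `A.MakesAtMost q`: the total number of samples and queries that `A` makes is at most `q`,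
whatever the oracles return. -/
def MakesAtMost {n : ℕ} : NonadaptiveAlg n → ℕ → Prop
  | query pts _, q => pts.length ≤ q
  | sample _, 0 => False
  | sample next, q + 1 => ∀ x : Cube n, (next x).MakesAtMost q

/-- The distribution of the answer of `A` on input `f`: each call of the sampling oracle returns
a fresh independent uniform element of `f⁻¹(1)`. -/
noncomputable def output {n : ℕ} (f : Cube n → Bool) (hf : (satSet f).Nonempty) :
    NonadaptiveAlg n → PMF Bool
  | sample next => (PMF.uniformOfFinset (satSet f) hf).bind fun x => output f hf (next x)
  | query pts accept => PMF.pure (accept (pts.map f))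

end NonadaptiveAlg

/-- A randomized non-adaptive algorithm: its internal randomness selects a deterministic one. -/
abbrev RandomizedAlg (n : ℕ) : Type := PMF (NonadaptiveAlg n)

/-- On every outcome of its internal randomness, `T` makes at most `q` samples and queries. -/
def RandomizedAlg.MakesAtMost {n : ℕ} (T : RandomizedAlg n) (q : ℕ) : Prop :=
  ∀ A ∈ T.support, A.MakesAtMost q

/-- The distribution of the answer of `T` on input `f`, over the internal randomness and the
samples. -/
noncomputable def RandomizedAlg.output {n : ℕ} (T : RandomizedAlg n) (f : Cube n → Bool)
    (hf : (satSet f).Nonempty) : PMF Bool :=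
  T.bind fun A => A.output f hf

/-- `T` is a (two-sided error) `ε`-relative-error tester for the class `𝒞` under the promise that
the unknown function lies in `𝓓`: it says "yes" with probability at least `2/3` on functions in
`𝒞`, and "no" with probability at least `2/3` on functions at relative distance at least `ε`
from `𝒞`. -/
def IsTesterUnderPromise {n : ℕ} (T : RandomizedAlg n) (ε : ℝ)
    (𝒞 𝓓 : Set (Cube n → Bool)) : Prop :=
  ∀ (f : Cube n → Bool) (hf : (satSet f).Nonempty), f ∈ 𝓓 →
    (f ∈ 𝒞 → 2 / 3 ≤ T.output f hf true) ∧
    (ε ≤ relDistTo f 𝒞 → 2 / 3 ≤ T.output f hf false)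

/-- The functions on `{0,1}^n` with `N / C ≤ |f⁻¹(1)| ≤ C * N`. -/
def sizeWithinFactor (n : ℕ) (C : ℝ) (N : ℕ) : Set (Cube n → Bool) :=
  {f | (N : ℝ) / C ≤ ((satSet f).card : ℝ) ∧ ((satSet f).card : ℝ) ≤ C * (N : ℝ)}

end RelativeError

/-!
Yao's principle is applied to two random families of Boolean functions, variants of Talagrand's
random DNF that are truncated at a middle layer. There are `6t` main variables, with `t` of order
`log N`; free variables bring the number of satisfying assignments to order `N`, and two flag
variables keep that number independent of the payloads below. The terms are about `1/p` random sets
of `t` variables, where `p` is the probability that a random term lies inside a given set of the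
layer `2t`. Where exactly one term and one flag are satisfied, the function reads off a payload
attached to the term, or its negation if it is the other flag. A random bit as payload gives a
decreasing, hence unate, function. A random literal `± v` as payload gives with constant probability
a function far from unate: with `k = 2t`, a constant fraction of the sets in the layer `k - 1`
contain exactly one term and still do so after `v` is added. Across such an edge the function
decreases or increases according to the flags, so that a unate function has to disagree with it on
many of these edges.

The two families can be coupled unless two of the points seen, of level at most `k`, satisfy a
common term and differ in its variable `v`. Deleting a term enlarges the set of satisfying
assignments by a factor of at most `1 + 4p`, so it increases expectations by at most `(1 + 4p) ^ q`,
which is bounded; after the deletion the term is a fresh random one that is independent of what the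
algorithm sees. Two sets of size at most `k` whose intersection has size at most `k - r` are both
satisfied with probability at most `p / 2 ^ r`, while sets with a larger intersection differ in at
most `2r` variables, so a fresh term separates on average at most `p q (2r + 1)` of the `6t`
variables if `r` is about `log (q t)`. A union bound over the `1/p` terms shows that
`q (2r + 1)` is at least of order `t`.
-/

namespace RelativeError

open Finset
open scoped BigOperators

/-! ### Running a non-adaptive algorithm -/

section Payoff

/-- A real quantity determined by the end of the sampling phase of a non-adaptive algorithm: a
function of the samples (latest first), the query points and the acceptance rule. -/
abbrev Payoff (n : ℕ) : Type :=
  List (Cube n) → List (Cube n) → (List Bool → Bool) → ℝ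

/-- The expectation of the payoff `G` when the algorithm runs on `f`, the samples in the list
having already been received. -/
noncomputable def expectedPayoff (f : Cube n → Bool) (G : Payoff n) :
    NonadaptiveAlg n → List (Cube n) → ℝ
  | .query pts accept, samples => G samples pts accept
  | .sample next, samples => 𝔼 x ∈ satSet f, expectedPayoff f G (next x) (x :: samples)

variable {n : ℕ} {f g : Cube n → Bool} {G G' : Payoff n}

theorem expectedPayoff_nonneg (hG : ∀ h pts a, 0 ≤ G h pts a) (A : NonadaptiveAlg n)
    (h : List (Cube n)) : 0 ≤ expectedPayoff f G A h := by
  induction A generalizing h with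
  | query pts a => exact hG _ _ _
  | sample next ih => exact expect_nonneg fun x _ => ih x _

theorem expectedPayoff_mono (hG : ∀ h pts a, G h pts a ≤ G' h pts a) (A : NonadaptiveAlg n)
    (h : List (Cube n)) : expectedPayoff f G A h ≤ expectedPayoff f G' A h := by
  induction A generalizing h with
  | query pts a => exact hG _ _ _
  | sample next ih => exact expect_le_expect fun x _ => ih x _

theorem expectedPayoff_sum {ι : Type*} (s : Finset ι) (G : ι → Payoff n) (A : NonadaptiveAlg n)
    (h : List (Cube n)) :
    expectedPayoff f (fun h pts a => ∑ i ∈ s, G i h pts a) A h =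
      ∑ i ∈ s, expectedPayoff f (G i) A h := by
  induction A generalizing h with
  | query pts a => rfl
  | sample next ih => simp only [expectedPayoff, ih, expect_sum_comm]

theorem expectedPayoff_expect {ι : Type*} (s : Finset ι) (G : ι → Payoff n) (A : NonadaptiveAlg n)
    (h : List (Cube n)) :
    expectedPayoff f (fun h pts a => 𝔼 i ∈ s, G i h pts a) A h =
      𝔼 i ∈ s, expectedPayoff f (G i) A h := by
  induction A generalizing h with
  | query pts a => rfl
  | sample next ih => simp only [expectedPayoff, ih, expect_comm (satSet f)]

theorem NonadaptiveAlg.makesAtMost_sample_iff {next : Cube n → NonadaptiveAlg n} {q : ℕ} :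
    (NonadaptiveAlg.sample next).MakesAtMost q ↔
      ∃ q', q = q' + 1 ∧ ∀ x, (next x).MakesAtMost q' := by
  cases q <;> simp [NonadaptiveAlg.MakesAtMost]

theorem expectedPayoff_le_of_le (hf : (satSet f).Nonempty) {c : ℝ} {Q : ℕ}
    (hG : ∀ h pts a, h.length + pts.length ≤ Q → G h pts a ≤ c) (A : NonadaptiveAlg n) (q : ℕ)
    (hA : A.MakesAtMost q) (h : List (Cube n)) (hQ : h.length + q ≤ Q) :
    expectedPayoff f G A h ≤ c := by
  induction A generalizing h q with
  | query pts a => exact hG _ _ _ ((Nat.add_le_add_left hA _).trans hQ)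
  | sample next ih =>
    obtain ⟨q, rfl, hnext⟩ := NonadaptiveAlg.makesAtMost_sample_iff.1 hA
    exact expect_le hf fun x _ => ih x q (hnext x) _ (by rw [List.length_cons]; lia)

theorem expect_le_mul_expect_of_subset {α : Type*} {s t : Finset α} (hst : s ⊆ t)
    (hs : s.Nonempty) {ρ : ℝ} (hcard : (#t : ℝ) ≤ ρ * #s) {F : α → ℝ} (hF : ∀ x, 0 ≤ F x) :
    𝔼 x ∈ s, F x ≤ ρ * 𝔼 x ∈ t, F x := by
  have hs_pos : (0 : ℝ) < #s := by exact_mod_cast hs.card_pos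
  have ht_pos : (0 : ℝ) < #t := by exact_mod_cast (hs.mono hst).card_pos
  rw [expect_eq_sum_div_card, expect_eq_sum_div_card, div_le_iff₀ hs_pos]
  calc ∑ x ∈ s, F x ≤ ∑ x ∈ t, F x := sum_le_sum_of_subset_of_nonneg hst fun x _ _ => hF x
    _ = (∑ x ∈ t, F x) / #t * #t := (div_mul_cancel₀ _ ht_pos.ne').symm
    _ ≤ (∑ x ∈ t, F x) / #t * (ρ * #s) := by
      gcongr
      exact div_nonneg (sum_nonneg fun x _ => hF x) ht_pos.le
    _ = ρ * ((∑ x ∈ t, F x) / #t) * #s := by ring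

theorem expectedPayoff_le_pow_mul (hf : (satSet f).Nonempty) (hfg : satSet f ⊆ satSet g) {ρ : ℝ}
    (hρ : 1 ≤ ρ) (hcard : (#(satSet g) : ℝ) ≤ ρ * #(satSet f))
    (hG : ∀ h pts a, 0 ≤ G h pts a) (A : NonadaptiveAlg n) (q : ℕ) (hA : A.MakesAtMost q)
    (h : List (Cube n)) :
    expectedPayoff f G A h ≤ ρ ^ q * expectedPayoff g G A h := by
  induction A generalizing h q with
  | query pts a => exact le_mul_of_one_le_left (hG _ _ _) (one_le_pow₀ hρ)
  | sample next ih =>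
    obtain ⟨q, rfl, hnext⟩ := NonadaptiveAlg.makesAtMost_sample_iff.1 hA
    calc expectedPayoff f G (.sample next) h
        ≤ 𝔼 x ∈ satSet f, ρ ^ q * expectedPayoff g G (next x) (x :: h) :=
          expect_le_expect fun x _ => ih x q (hnext x) _
      _ = ρ ^ q * 𝔼 x ∈ satSet f, expectedPayoff g G (next x) (x :: h) := (mul_expect _ _ _).symm
      _ ≤ ρ ^ q * (ρ * 𝔼 x ∈ satSet g, expectedPayoff g G (next x) (x :: h)) := by
          gcongr
          exact expect_le_mul_expect_of_subset hfg hf hcard fun x => expectedPayoff_nonneg hG _ _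
      _ = ρ ^ (q + 1) * expectedPayoff g G (.sample next) h := by rw [expectedPayoff]; ring

end Payoff

section AcceptProb

variable {n : ℕ} {f : Cube n → Bool}

/-- The indicator that the answers which `f` gives to the queries lead to "yes". -/
noncomputable def acceptPayoff (f : Cube n → Bool) : Payoff n :=
  fun _ pts accept => if accept (pts.map f) then 1 else 0

theorem acceptPayoff_nonneg (f : Cube n → Bool) (h pts a) : 0 ≤ acceptPayoff f h pts a := by
  rw [acceptPayoff]
  positivity

theorem acceptPayoff_le_one (f : Cube n → Bool) (h pts a) : acceptPayoff f h pts a ≤ 1 := by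
  rw [acceptPayoff]
  split_ifs <;> norm_num

/-- The probability that `A` says "yes" on `f`, as a real number. -/
noncomputable def acceptProb (f : Cube n → Bool) (A : NonadaptiveAlg n) : ℝ :=
  expectedPayoff f (acceptPayoff f) A []

theorem acceptProb_nonneg (f : Cube n → Bool) (A : NonadaptiveAlg n) : 0 ≤ acceptProb f A :=
  expectedPayoff_nonneg (acceptPayoff_nonneg f) _ _

theorem NonadaptiveAlg.output_true (hf : (satSet f).Nonempty) (A : NonadaptiveAlg n)
    (h : List (Cube n)) :
    A.output f hf true = ENNReal.ofReal (expectedPayoff f (acceptPayoff f) A h) := by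
  induction A generalizing h with
  | query pts a =>
    simp only [NonadaptiveAlg.output, PMF.pure_apply, expectedPayoff, acceptPayoff]
    cases a (pts.map f) <;> simp
  | sample next ih =>
    have hc : (0 : ℝ) < #(satSet f) := by exact_mod_cast hf.card_pos
    rw [NonadaptiveAlg.output, PMF.bind_apply, tsum_fintype, expectedPayoff,
      expect_eq_sum_div_card, ENNReal.ofReal_div_of_pos hc, ENNReal.ofReal_sum_of_nonneg
        fun x _ => expectedPayoff_nonneg (acceptPayoff_nonneg f) _ _,
      ENNReal.ofReal_natCast, div_eq_mul_inv, sum_mul, ← sum_subset (subset_univ (satSet f))]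
    · exact sum_congr rfl fun x hx => by
        rw [PMF.uniformOfFinset_apply_of_mem hf hx, ih x (x :: h), mul_comm]
    · exact fun x _ hx => by rw [PMF.uniformOfFinset_apply_of_notMem hf hx, zero_mul]

theorem RandomizedAlg.sum_output_true {I : Type*} (s : Finset I) {W : I → Cube n → Bool}
    (hW : ∀ i, (satSet (W i)).Nonempty) (T : RandomizedAlg n) :
    ∑ i ∈ s, T.output (W i) (hW i) true =
      ∑' A, T A * ENNReal.ofReal (∑ i ∈ s, acceptProb (W i) A) := by
  have output_true (i : I) :
      T.output (W i) (hW i) true = ∑' A, T A * ENNReal.ofReal (acceptProb (W i) A) := by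
    rw [RandomizedAlg.output, PMF.bind_apply]
    exact tsum_congr fun A => congrArg _ (NonadaptiveAlg.output_true (hW i) A [])
  simp_rw [output_true]
  rw [← Summable.tsum_finsetSum fun _ _ => ENNReal.summable]
  exact tsum_congr fun A => by
    rw [ENNReal.ofReal_sum_of_nonneg fun i _ => acceptProb_nonneg _ _, mul_sum]

theorem RandomizedAlg.sum_output_true_le {I : Type*} {s : Finset I} {Y Z : I → Cube n → Bool}
    (hY : ∀ i, (satSet (Y i)).Nonempty) (hZ : ∀ i, (satSet (Z i)).Nonempty) (T : RandomizedAlg n)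
    {δ : ℝ} (hδ : 0 ≤ δ)
    (hA : ∀ A ∈ T.support, ∑ i ∈ s, acceptProb (Y i) A ≤ ∑ i ∈ s, acceptProb (Z i) A + δ) :
    ∑ i ∈ s, T.output (Y i) (hY i) true
      ≤ ∑ i ∈ s, T.output (Z i) (hZ i) true + ENNReal.ofReal δ := by
  rw [sum_output_true, sum_output_true]
  calc ∑' A, T A * ENNReal.ofReal (∑ i ∈ s, acceptProb (Y i) A)
      ≤ ∑' A, (T A * ENNReal.ofReal (∑ i ∈ s, acceptProb (Z i) A) + T A * ENNReal.ofReal δ) := by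
        refine ENNReal.tsum_le_tsum fun A => ?_
        by_cases hAT : A ∈ T.support
        · rw [← mul_add, ← ENNReal.ofReal_add (sum_nonneg fun i _ => acceptProb_nonneg _ _) hδ]
          gcongr
          exact hA A hAT
        · simp [(PMF.apply_eq_zero_iff T A).2 hAT]
    _ = ∑' A, T A * ENNReal.ofReal (∑ i ∈ s, acceptProb (Z i) A) + ENNReal.ofReal δ := by
        rw [ENNReal.tsum_add, ENNReal.tsum_mul_right, T.tsum_coe, one_mul]

theorem toReal_output_true_le_one_third {P : PMF Bool} (h : 2 / 3 ≤ P false) :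
    (P true).toReal ≤ 1 / 3 := by
  have htotal : (P true).toReal + (P false).toReal = 1 := by
    have hsum := P.tsum_coe
    rw [tsum_fintype, Fintype.sum_bool] at hsum
    rw [← ENNReal.toReal_add (P.apply_ne_top _) (P.apply_ne_top _), hsum, ENNReal.toReal_one]
  have hfalse : 2 / 3 ≤ (P false).toReal := by
    simpa using ENNReal.toReal_mono (P.apply_ne_top _) h
  linarith

theorem card_le_three_mul_of_acceptProb_le {I : Type*} {s : Finset I} {Y Z : I → Cube n → Bool}
    (hY : ∀ i, (satSet (Y i)).Nonempty) (hZ : ∀ i, (satSet (Z i)).Nonempty) {T : RandomizedAlg n}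
    (hTY : ∀ i ∈ s, 2 / 3 ≤ T.output (Y i) (hY i) true)
    (hTZ : ∀ i ∈ s, 2 / 3 ≤ T.output (Z i) (hZ i) false) {δ : ℝ} (hδ : 0 ≤ δ)
    (hA : ∀ A ∈ T.support, ∑ i ∈ s, acceptProb (Y i) A ≤ ∑ i ∈ s, acceptProb (Z i) A + δ) :
    (#s : ℝ) ≤ 3 * δ := by
  have hYZ : ∑ i ∈ s, (T.output (Y i) (hY i) true).toReal
      ≤ ∑ i ∈ s, (T.output (Z i) (hZ i) true).toReal + δ := by
    have hsum := T.sum_output_true_le hY hZ hδ hA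
    rw [← ENNReal.toReal_ofReal hδ, ← ENNReal.toReal_sum fun i _ => PMF.apply_ne_top _ _,
      ← ENNReal.toReal_sum fun i _ => PMF.apply_ne_top _ _, ← ENNReal.toReal_add
        (ENNReal.sum_ne_top.2 fun i _ => PMF.apply_ne_top _ _) ENNReal.ofReal_ne_top]
    exact ENNReal.toReal_mono (ENNReal.add_ne_top.2
      ⟨ENNReal.sum_ne_top.2 fun i _ => PMF.apply_ne_top _ _, ENNReal.ofReal_ne_top⟩) hsum
  have hYes : #s • (2 / 3 : ℝ) ≤ ∑ i ∈ s, (T.output (Y i) (hY i) true).toReal :=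
    card_nsmul_le_sum _ _ _ fun i hi => by
      simpa using ENNReal.toReal_mono (PMF.apply_ne_top _ _) (hTY i hi)
  have hNo : ∑ i ∈ s, (T.output (Z i) (hZ i) true).toReal ≤ #s • (1 / 3 : ℝ) :=
    sum_le_card_nsmul _ _ _ fun i hi => toReal_output_true_le_one_third (hTZ i hi)
  rw [nsmul_eq_mul] at hYes hNo
  linarith

end AcceptProb

/-! ### Coordinate blocks -/

/-- A placement of main coordinates indexed by `μ`, of two flags (the summand `Bool`) and of free
coordinates indexed by `φ` among the `n` coordinates of the cube. The other coordinates serve as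
padding. -/
abbrev Layout (μ φ : Type*) (n : ℕ) : Type _ := μ ⊕ Bool ⊕ φ ↪ Fin n

namespace Layout

variable {n : ℕ} {μ φ : Type*} (L : Layout μ φ n)

/-- The position of a main coordinate. -/
def main (i : μ) : Fin n := L (.inl i)

/-- The position of a flag. -/
def flag (s : Bool) : Fin n := L (.inr (.inl s))

/-- The values of the two flags. -/
def flags (u : Cube n) (s : Bool) : Bool := u (L.flag s)

/-- The set of main coordinates equal to `true`. -/
def ones [Fintype μ] (u : Cube n) : Finset μ := {i | u (L.main i) = true}

/-- The padding is `false`. -/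
def Supported (u : Cube n) : Prop := ∀ i ∉ Set.range L, u i = false

/-- The supported point with given main, flag and free parts. -/
noncomputable def point [DecidableEq μ] (X : Finset μ) (c : Bool → Bool) (y : φ → Bool) : Cube n :=
  Function.extend L (Sum.elim (fun i => decide (i ∈ X)) (Sum.elim c y)) fun _ => false

variable {L}

theorem main_injective : Function.Injective L.main :=
  L.injective.comp Sum.inl_injective

theorem finite_free (L : Layout μ φ n) : Finite φ :=
  .of_injective _ (L.injective.comp (Sum.inr_injective.comp Sum.inr_injective))

theorem main_ne_flag (i : μ) (s : Bool) : L.main i ≠ L.flag s :=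
  L.injective.ne Sum.inl_ne_inr

theorem supported_update_main {u : Cube n} (i : μ) (v : Bool) :
    L.Supported (Function.update u (L.main i) v) ↔ L.Supported u := by
  refine forall₂_congr fun j hj => ?_
  rw [Function.update_of_ne]
  rintro rfl
  exact hj ⟨_, rfl⟩

theorem flags_update_main (u : Cube n) (i : μ) (v : Bool) :
    L.flags (Function.update u (L.main i) v) = L.flags u :=
  funext fun s => Function.update_of_ne (main_ne_flag i s).symm _ _

theorem flags_mono {u v : Cube n} (h : u ≤ v) : L.flags u ≤ L.flags v := fun s => h (L.flag s)

theorem Supported.of_le {u v : Cube n} (h : u ≤ v) (hv : L.Supported v) : L.Supported u :=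
  fun i hi => eq_bot_mono (h i) (hv i hi)

section Ones

variable [Fintype μ]

@[simp] theorem mem_ones {u : Cube n} {i : μ} : i ∈ L.ones u ↔ u (L.main i) = true := by
  simp [ones]

theorem ones_mono {u v : Cube n} (h : u ≤ v) : L.ones u ⊆ L.ones v := fun i hi => by
  rw [mem_ones] at hi ⊢
  exact eq_top_mono (h (L.main i)) hi

theorem ones_update_main_true [DecidableEq μ] (u : Cube n) (i : μ) :
    L.ones (Function.update u (L.main i) true) = insert i (L.ones u) := by
  ext j
  obtain rfl | hj := eq_or_ne j i
  · simp
  · simp [hj, Function.update_of_ne (main_injective.ne hj)]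

end Ones

section Cylinder

variable [DecidableEq μ]

theorem ones_point [Fintype μ] (X : Finset μ) (c : Bool → Bool) (y : φ → Bool) :
    L.ones (L.point X c y) = X := by
  ext i
  simp [main, point, L.injective.extend_apply]

theorem flags_point (X : Finset μ) (c : Bool → Bool) (y : φ → Bool) :
    L.flags (L.point X c y) = c := by
  ext s
  simp [flags, flag, point, L.injective.extend_apply]

theorem supported_point (X : Finset μ) (c : Bool → Bool) (y : φ → Bool) :
    L.Supported (L.point X c y) :=
  fun _ hi => Function.extend_apply' _ _ _ hi

theorem Supported.point_eq [Fintype μ] {u : Cube n} (hu : L.Supported u) :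
    L.point (L.ones u) (L.flags u) (fun i => u (L (.inr (.inr i)))) = u := by
  ext i
  by_cases hi : i ∈ Set.range L
  · obtain ⟨i | s | i, rfl⟩ := hi <;>
      simp [point, L.injective.extend_apply, main, flags, flag]
  · rw [hu i hi, supported_point _ _ _ i hi]

theorem point_injective (c : Bool → Bool) :
    Function.Injective fun p : Finset μ × (φ → Bool) => L.point p.1 c p.2 := by
  rintro ⟨X, y⟩ ⟨X', y'⟩ h
  refine Prod.ext (Finset.ext fun i => ?_) (funext fun i => ?_)
  · simpa [point, L.injective.extend_apply] using congrFun h (L (.inl i))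
  · simpa [point, L.injective.extend_apply] using congrFun h (L (.inr (.inr i)))

variable [Fintype φ] (L)

open Classical in
/-- The supported points whose flags are `c` and whose main part belongs to `S`. -/
noncomputable def cylinder (c : Bool → Bool) (S : Finset (Finset μ)) : Finset (Cube n) :=
  (S ×ˢ univ).map ⟨fun p => L.point p.1 c p.2, point_injective c⟩

variable {L}

theorem card_cylinder (c : Bool → Bool) (S : Finset (Finset μ)) :
    #(L.cylinder c S) = #S * 2 ^ Fintype.card φ := by
  simp [cylinder]

variable [Fintype μ]

theorem mem_cylinder {c : Bool → Bool} {S : Finset (Finset μ)} {u : Cube n} :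
    u ∈ L.cylinder c S ↔ L.Supported u ∧ L.flags u = c ∧ L.ones u ∈ S := by
  simp only [cylinder, mem_map, mem_product, mem_univ, and_true, Prod.exists,
    Function.Embedding.coeFn_mk]
  constructor
  · rintro ⟨X, y, hX, rfl⟩
    exact ⟨supported_point X c y, flags_point X c y, by rwa [ones_point]⟩
  · rintro ⟨hu, rfl, hX⟩
    exact ⟨L.ones u, _, hX, hu.point_eq⟩

end Cylinder

section SwapFlags

variable (L)

/-- The symmetry of the cube that exchanges the two flags. -/
def swapFlags : Cube n ≃ Cube n :=
  (Equiv.swap (L.flag false) (L.flag true)).arrowCongr (Equiv.refl Bool)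

variable {L}

theorem swapFlags_of_ne {u : Cube n} {i : Fin n} (h : ∀ s, i ≠ L.flag s) :
    L.swapFlags u i = u i := by
  simp [swapFlags, Equiv.swap_apply_of_ne_of_ne (h false) (h true)]

theorem flags_swapFlags (u : Cube n) : L.flags (L.swapFlags u) = L.flags u ∘ not := by
  ext s
  cases s <;> simp [flags, swapFlags]

theorem ones_swapFlags [Fintype μ] (u : Cube n) : L.ones (L.swapFlags u) = L.ones u := by
  ext i
  simp [swapFlags_of_ne (main_ne_flag i)]

theorem supported_swapFlags {u : Cube n} : L.Supported (L.swapFlags u) ↔ L.Supported u := by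
  refine forall₂_congr fun i hi => ?_
  rw [swapFlags_of_ne]
  rintro s rfl
  exact hi ⟨_, rfl⟩

end SwapFlags

end Layout

/-! ### Truncated Talagrand functions -/

section TruncatedTalagrand

variable {n : ℕ} {μ φ ι : Type*} [DecidableEq μ] {R R' : Finset ι}
  {T T' : ι → Finset μ} {X Y : Finset μ}

/-- The terms with index in `R` that are satisfied when the true variables are those of `X`. -/
def satisfied (R : Finset ι) (T : ι → Finset μ) (X : Finset μ) : Finset ι :=
  {j ∈ R | T j ⊆ X}

theorem mem_satisfied {j : ι} : j ∈ satisfied R T X ↔ j ∈ R ∧ T j ⊆ X := mem_filter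

theorem satisfied_mono (h : X ⊆ Y) : satisfied R T X ⊆ satisfied R T Y :=
  monotone_filter_right R fun _ _ hj => hj.trans h

theorem satisfied_subset (h : R' ⊆ R) (X : Finset μ) : satisfied R' T X ⊆ satisfied R T X :=
  filter_subset_filter _ h

theorem satisfied_congr (h : ∀ j ∈ R, T j = T' j) (X : Finset μ) :
    satisfied R T X = satisfied R T' X :=
  filter_congr fun j hj => by rw [h j hj]

theorem satisfied_erase_of_not_subset [DecidableEq ι] {j : ι} (h : ¬ T j ⊆ X) :
    satisfied (R.erase j) T X = satisfied R T X := by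
  rw [satisfied, filter_erase, ← satisfied, erase_eq_of_notMem fun hj => h (mem_satisfied.1 hj).2]

variable [Fintype μ]

/-- The condition under which a Talagrand-style function with terms `T`, truncated above level `k`
and depending on the terms only on the levels `k - 1` and `k`, takes the value `true`. Where exactly
one term `j` is satisfied and exactly one flag is set, the function equals the payload `pay j` or
its negation, depending on which flag is set. -/
def TruncatedTalagrandSat (L : Layout μ φ n) (k : ℕ) (R : Finset ι) (T : ι → Finset μ)
    (pay : ι → Finset μ → Bool) (u : Cube n) : Prop :=
  L.Supported u ∧ #(L.ones u) ≤ k ∧ (∃ s, L.flags u s = false) ∧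
    ((∀ s, L.flags u s = false) ∨ #(L.ones u) + 1 < k ∨ satisfied R T (L.ones u) = ∅ ∨
      ∃ j, satisfied R T (L.ones u) = {j} ∧ pay j (L.ones u) ≠ L.flags u true)

open Classical in
/-- The Boolean function of `TruncatedTalagrandSat`. -/
noncomputable def truncatedTalagrand (L : Layout μ φ n) (k : ℕ) (R : Finset ι) (T : ι → Finset μ)
    (pay : ι → Finset μ → Bool) (u : Cube n) : Bool :=
  decide (TruncatedTalagrandSat L k R T pay u)

variable {L : Layout μ φ n} {k : ℕ} {pay pay' : ι → Finset μ → Bool} {u v : Cube n}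

theorem truncatedTalagrand_eq_true :
    truncatedTalagrand L k R T pay u = true ↔ TruncatedTalagrandSat L k R T pay u := by
  simp [truncatedTalagrand]

theorem mem_satSet_truncatedTalagrand :
    u ∈ satSet (truncatedTalagrand L k R T pay) ↔ TruncatedTalagrandSat L k R T pay u := by
  simp [satSet, truncatedTalagrand_eq_true]

theorem truncatedTalagrand_congr (h : ∀ j ∈ R, T j = T' j) :
    truncatedTalagrand L k R T pay = truncatedTalagrand L k R T' pay := by
  have hsat : satisfied R T = satisfied R T' := funext (satisfied_congr h)
  unfold truncatedTalagrand TruncatedTalagrandSat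
  rw [hsat]

theorem eq_empty_or_singleton_of_subset {α : Type*} {s t : Finset α} {p : α → Prop} (hts : t ⊆ s)
    (h : s = ∅ ∨ ∃ j, s = {j} ∧ p j) : t = ∅ ∨ ∃ j, t = {j} ∧ p j := by
  rcases h with rfl | ⟨j, rfl, hj⟩
  · exact .inl (subset_empty.1 hts)
  · exact (subset_singleton_iff.1 hts).imp_right fun ht => ⟨j, ht, hj⟩

theorem TruncatedTalagrandSat.mono (hR : R' ⊆ R) (h : TruncatedTalagrandSat L k R T pay u) :
    TruncatedTalagrandSat L k R' T pay u := by
  obtain ⟨hsupp, hk, hflag, h⟩ := h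
  exact ⟨hsupp, hk, hflag, h.imp_right fun h => h.imp_right
    (eq_empty_or_singleton_of_subset (satisfied_subset hR _))⟩

theorem apply_true_eq_of_le {c d : Bool → Bool} (hcd : ∀ s, c s ≤ d s) (hd : ∃ s, d s = false)
    (hc : ¬ ∀ s, c s = false) : c true = d true := by
  revert c d
  decide

theorem TruncatedTalagrandSat.anti {β : ι → Bool} (huv : u ≤ v)
    (h : TruncatedTalagrandSat L k R T (fun j _ => β j) v) :
    TruncatedTalagrandSat L k R T (fun j _ => β j) u := by
  obtain ⟨hsupp, hk, ⟨s, hs⟩, h⟩ := h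
  have hflags := Layout.flags_mono (L := L) huv
  have hones := Layout.ones_mono (L := L) huv
  refine ⟨hsupp.of_le huv, (card_le_card hones).trans hk, ⟨s, eq_bot_mono (hflags s) hs⟩, ?_⟩
  by_cases hzero : ∀ s, L.flags u s = false
  · exact .inl hzero
  have heq := apply_true_eq_of_le hflags ⟨s, hs⟩ hzero
  rcases h with h | h | h
  · exact absurd (fun s => eq_bot_mono (hflags s) (h s)) hzero
  · exact .inr (.inl ((Nat.succ_le_succ (card_le_card hones)).trans_lt h))
  · exact .inr (.inr (heq ▸ eq_empty_or_singleton_of_subset (satisfied_mono hones) h))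

theorem truncatedTalagrand_mem_unate (β : ι → Bool) :
    truncatedTalagrand L k R T (fun j _ => β j) ∈ unate n := fun i => .inr fun x => by
  rw [Bool.le_iff_imp, truncatedTalagrand_eq_true, truncatedTalagrand_eq_true]
  exact .anti (update_le_update_iff.2 ⟨Bool.false_le _, fun j _ => le_rfl⟩)

open Classical in
theorem boole_truncatedTalagrandSat_add_swapFlags (pay pay' : ι → Finset μ → Bool) (u : Cube n) :
    ((if TruncatedTalagrandSat L k R T pay u then 1 else 0) +
        if TruncatedTalagrandSat L k R T pay (L.swapFlags u) then 1 else 0) =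
      (if TruncatedTalagrandSat L k R T pay' u then 1 else 0) +
        if TruncatedTalagrandSat L k R T pay' (L.swapFlags u) then 1 else 0 := by
  simp only [TruncatedTalagrandSat, Layout.supported_swapFlags, Layout.ones_swapFlags,
    Layout.flags_swapFlags, Function.comp_apply, Bool.exists_bool, Bool.forall_bool,
    Bool.not_true, Bool.not_false]
  by_cases hj : ∃ j, satisfied R T (L.ones u) = {j}
  · obtain ⟨j, hj⟩ := hj
    simp only [hj, singleton_ne_empty, singleton_inj, exists_eq_left', false_or]
    cases L.flags u true <;> cases L.flags u false <;> cases pay j (L.ones u) <;>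
      cases pay' j (L.ones u) <;> simp [add_comm]
  · have hfalse (q : ι → Prop) : (∃ j, satisfied R T (L.ones u) = {j} ∧ q j) ↔ False :=
      iff_false_intro fun ⟨j, h, _⟩ => hj ⟨j, h⟩
    simp only [hfalse]

theorem card_satSet_truncatedTalagrand_congr (pay pay' : ι → Finset μ → Bool) :
    #(satSet (truncatedTalagrand L k R T pay)) = #(satSet (truncatedTalagrand L k R T pay')) := by
  classical
  have two_mul_card (p : ι → Finset μ → Bool) : 2 * #(satSet (truncatedTalagrand L k R T p)) =
      ∑ u : Cube n, ((if TruncatedTalagrandSat L k R T p u then 1 else 0) +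
        if TruncatedTalagrandSat L k R T p (L.swapFlags u) then 1 else 0) := by
    rw [sum_add_distrib, L.swapFlags.sum_comp fun u =>
      if TruncatedTalagrandSat L k R T p u then 1 else 0, ← two_mul, sum_boole]
    simp [satSet, truncatedTalagrand]
  have h := two_mul_card pay
  simp only [boole_truncatedTalagrandSat_add_swapFlags pay pay', ← two_mul_card pay'] at h
  exact Nat.eq_of_mul_eq_mul_left two_pos h

end TruncatedTalagrand

section Cardinality

theorem two_mul_choose_le_choose_succ {m k : ℕ} (h : 3 * (k + 1) ≤ m) :
    2 * m.choose k ≤ m.choose (k + 1) := by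
  refine Nat.le_of_mul_le_mul_right ?_ k.succ_pos
  calc 2 * m.choose k * (k + 1) = m.choose k * (2 * (k + 1)) := by ring
    _ ≤ m.choose k * (m - k) := by gcongr; lia
    _ = m.choose (k + 1) * (k + 1) := (Nat.choose_succ_right_eq m k).symm

/-- The probability that a uniformly random set of `t` of `m` variables lies inside a given set of
`k` variables. -/
noncomputable def termProb (m k t : ℕ) : ℝ := k.choose t / m.choose t

theorem termProb_nonneg (m k t : ℕ) : 0 ≤ termProb m k t := by
  rw [termProb]
  positivity

variable {n : ℕ} {μ φ ι : Type*} [Fintype μ] {k : ℕ}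

theorem card_finsets_card_le_le (h : 3 * k ≤ Fintype.card μ) :
    #{X : Finset μ | #X ≤ k} ≤ 2 * (Fintype.card μ).choose k := by
  classical
  induction k with
  | zero => simp [filter_eq']
  | succ k ih =>
    have hsplit : ({X | #X ≤ k + 1} : Finset (Finset μ)) =
        ({X | #X ≤ k} : Finset (Finset μ)) ∪ powersetCard (k + 1) univ := by
      ext X
      simp [mem_powersetCard, Nat.le_succ_iff]
    calc #{X : Finset μ | #X ≤ k + 1}
        ≤ #{X : Finset μ | #X ≤ k} + (Fintype.card μ).choose (k + 1) := by
          rw [hsplit, ← card_univ, ← card_powersetCard]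
          exact card_union_le _ _
      _ ≤ 2 * (Fintype.card μ).choose k + (Fintype.card μ).choose (k + 1) := by
          gcongr
          exact ih (by lia)
      _ ≤ 2 * (Fintype.card μ).choose (k + 1) := by
          linarith [two_mul_choose_le_choose_succ h]

variable [DecidableEq μ]

theorem card_powersetCard_filter_subset_le {τ : Finset μ} (hm : 3 * k ≤ Fintype.card μ)
    (hτ : #τ < k) :
    (#{X ∈ powersetCard k univ ∪ powersetCard (k - 1) univ | τ ⊆ X} : ℝ) ≤
      2 * termProb (Fintype.card μ) k #τ * (Fintype.card μ).choose k := by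
  set m := Fintype.card μ
  have hpos : (0 : ℝ) < m.choose #τ := by exact_mod_cast Nat.choose_pos (by lia)
  have hmono : (m - #τ).choose (k - 1 - #τ) ≤ (m - #τ).choose (k - #τ) := by
    rw [show k - #τ = k - 1 - #τ + 1 by lia]
    exact Nat.choose_le_succ_of_lt_half_left (by lia)
  have hcard :
      #{X ∈ powersetCard k univ ∪ powersetCard (k - 1) univ | τ ⊆ X} ≤
        2 * (m - #τ).choose (k - #τ) := by
    rw [filter_union, two_mul]
    refine (card_union_le _ _).trans (add_le_add ?_ (le_trans ?_ hmono))
    · rw [card_filter_powersetCard_subset _ _ _ (subset_univ τ) hτ.le, card_univ]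
    · rw [card_filter_powersetCard_subset _ _ _ (subset_univ τ) (by lia), card_univ]
  have htrade : (m.choose k : ℝ) * k.choose #τ = m.choose #τ * (m - #τ).choose (k - #τ) := by
    exact_mod_cast Nat.choose_mul hτ.le
  calc _ ≤ 2 * ((m - #τ).choose (k - #τ) : ℝ) := by exact_mod_cast hcard
    _ = 2 * termProb m k #τ * m.choose k := by rw [termProb]; field_simp; linarith

variable {L : Layout μ φ n} {R : Finset ι} {T : ι → Finset μ} {pay : ι → Finset μ → Bool}

theorem satSet_truncatedTalagrand_nonempty :
    (satSet (truncatedTalagrand L k R T pay)).Nonempty := by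
  refine ⟨L.point ∅ (fun _ => false) fun _ => false, mem_satSet_truncatedTalagrand.2 ?_⟩
  simp [TruncatedTalagrandSat, Layout.supported_point, Layout.ones_point, Layout.flags_point]

theorem choose_mul_le_card_satSet [Fintype φ] :
    (Fintype.card μ).choose k * 2 ^ Fintype.card φ ≤
      #(satSet (truncatedTalagrand L k R T pay)) := by
  rw [← card_univ (α := μ), ← card_powersetCard, ← Layout.card_cylinder (L := L) fun _ => false]
  refine card_le_card fun u hu => ?_
  obtain ⟨hsupp, hflags, hones⟩ := Layout.mem_cylinder.1 hu
  rw [mem_satSet_truncatedTalagrand]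
  exact ⟨hsupp, (mem_powersetCard.1 hones).2.le, ⟨true, congrFun hflags true⟩,
    .inl (congrFun hflags)⟩

theorem flags_eq_of_exists_eq_false {c : Bool → Bool} (h : ∃ s, c s = false) :
    c = (fun _ => false) ∨ c = id ∨ c = not := by
  revert h c
  decide

theorem card_satSet_le [Fintype φ] (h : 3 * k ≤ Fintype.card μ) :
    #(satSet (truncatedTalagrand L k R T pay)) ≤
      6 * ((Fintype.card μ).choose k * 2 ^ Fintype.card φ) := by
  set A : (Bool → Bool) → Finset (Cube n) := fun c => L.cylinder c {X | #X ≤ k} with hA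
  have hcard (c : Bool → Bool) : #(A c) ≤ 2 * ((Fintype.card μ).choose k * 2 ^ Fintype.card φ) := by
    rw [hA, Layout.card_cylinder, ← mul_assoc]
    gcongr
    exact card_finsets_card_le_le h
  have hsub : satSet (truncatedTalagrand L k R T pay) ⊆ A (fun _ => false) ∪ (A id ∪ A not) := by
    intro u hu
    obtain ⟨hsupp, hones, hflags, -⟩ := mem_satSet_truncatedTalagrand.1 hu
    simpa [hA, Layout.mem_cylinder, hsupp, hones] using flags_eq_of_exists_eq_false hflags
  calc _ ≤ #(A fun _ => false) + (#(A id) + #(A not)) :=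
        (card_le_card hsub).trans ((card_union_le _ _).trans (by gcongr; exact card_union_le _ _))
    _ ≤ _ := by linarith [hcard fun _ => false, hcard id, hcard not]

variable [DecidableEq ι]

theorem satSet_truncatedTalagrand_erase_subset [Fintype φ] (j : ι) :
    satSet (truncatedTalagrand L k (R.erase j) T pay) ⊆
      satSet (truncatedTalagrand L k R T pay) ∪
        (L.cylinder id {X ∈ powersetCard k univ ∪ powersetCard (k - 1) univ | T j ⊆ X} ∪
          L.cylinder not {X ∈ powersetCard k univ ∪ powersetCard (k - 1) univ | T j ⊆ X}) := by
  intro u hu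
  obtain ⟨hsupp, hones, hflags, hu⟩ := mem_satSet_truncatedTalagrand.1 hu
  simp only [mem_union, mem_satSet_truncatedTalagrand, Layout.mem_cylinder, hsupp, mem_filter,
    mem_powersetCard, subset_univ, true_and]
  by_cases hzero : ∀ s, L.flags u s = false
  · exact .inl ⟨hsupp, hones, hflags, .inl hzero⟩
  by_cases hlow : #(L.ones u) + 1 < k
  · exact .inl ⟨hsupp, hones, hflags, .inr (.inl hlow)⟩
  by_cases hT : T j ⊆ L.ones u
  · refine .inr (((flags_eq_of_exists_eq_false hflags).resolve_left
      fun h => hzero (congrFun h)).imp ?_ ?_) <;>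
    exact fun h => ⟨h, by lia, hT⟩
  · rw [satisfied_erase_of_not_subset hT] at hu
    exact .inl ⟨hsupp, hones, hflags, hu⟩

theorem card_satSet_erase_le {j : ι} (hm : 3 * k ≤ Fintype.card μ) (hj : #(T j) < k) :
    (#(satSet (truncatedTalagrand L k (R.erase j) T pay)) : ℝ) ≤
      (1 + 4 * termProb (Fintype.card μ) k #(T j)) *
        #(satSet (truncatedTalagrand L k R T pay)) := by
  have := L.finite_free
  have := Fintype.ofFinite φ
  have hcard : #(satSet (truncatedTalagrand L k (R.erase j) T pay)) ≤
      #(satSet (truncatedTalagrand L k R T pay)) +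
        2 * (#{X ∈ powersetCard k univ ∪ powersetCard (k - 1) univ | T j ⊆ X} *
          2 ^ Fintype.card φ) := by
    refine (card_le_card (satSet_truncatedTalagrand_erase_subset j)).trans
      ((card_union_le _ _).trans ?_)
    gcongr
    refine (card_union_le _ _).trans ?_
    rw [Layout.card_cylinder, Layout.card_cylinder, two_mul]
  have hW : ((Fintype.card μ).choose k * 2 ^ Fintype.card φ : ℝ) ≤
      #(satSet (truncatedTalagrand L k R T pay)) := by
    exact_mod_cast choose_mul_le_card_satSet
  calc _ ≤ (#(satSet (truncatedTalagrand L k R T pay)) : ℝ) +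
        2 * (#{X ∈ powersetCard k univ ∪ powersetCard (k - 1) univ | T j ⊆ X} *
          2 ^ Fintype.card φ) := by exact_mod_cast hcard
    _ ≤ #(satSet (truncatedTalagrand L k R T pay)) +
        2 * (2 * termProb (Fintype.card μ) k #(T j) * (Fintype.card μ).choose k *
          2 ^ Fintype.card φ) := by
      gcongr
      exact card_powersetCard_filter_subset_le hm hj
    _ = #(satSet (truncatedTalagrand L k R T pay)) + 4 * termProb (Fintype.card μ) k #(T j) *
        ((Fintype.card μ).choose k * 2 ^ Fintype.card φ) := by ring
    _ ≤ #(satSet (truncatedTalagrand L k R T pay)) + 4 * termProb (Fintype.card μ) k #(T j) *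
        #(satSet (truncatedTalagrand L k R T pay)) := by
      gcongr
      exact mul_nonneg zero_le_four (termProb_nonneg _ _ _)
    _ = _ := by ring

end Cardinality

/-! ### Coupling -/

section Coupling

variable {n : ℕ} {B : Type*} [Fintype B] {f g : B → Cube n → Bool} {Z : ℕ}

open Classical in
/-- The total expected payoff over the members of a finite family of functions that take the value
`true` at all the given samples. Up to normalization this is the posterior expectation, given the
samples, over a uniformly random member of a family of functions with equally many satisfying
assignments. -/
noncomputable def totalPayoff (f : B → Cube n → Bool) (G : B → Payoff n) (A : NonadaptiveAlg n)
    (h : List (Cube n)) : ℝ :=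
  ∑ β with ∀ x ∈ h, f β x = true, expectedPayoff (f β) (G β) A h

theorem totalPayoff_nil (f : B → Cube n → Bool) (G : B → Payoff n) (A : NonadaptiveAlg n) :
    totalPayoff f G A [] = ∑ β, expectedPayoff (f β) (G β) A [] := by
  simp [totalPayoff]

theorem totalPayoff_sample (hZ : ∀ β, #(satSet (f β)) = Z) (G : B → Payoff n)
    (next : Cube n → NonadaptiveAlg n) (h : List (Cube n)) :
    totalPayoff f G (.sample next) h = (∑ x, totalPayoff f G (next x) (x :: h)) / Z := by
  classical
  simp only [totalPayoff, expectedPayoff, expect_eq_sum_div_card, hZ]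
  rw [← sum_div]
  congr 1
  simp only [satSet, sum_filter, List.forall_mem_cons]
  rw [sum_comm]
  refine sum_congr rfl fun β _ => ?_
  by_cases hβ : ∀ x ∈ h, f β x = true
  · rw [if_pos hβ]
    exact sum_congr rfl fun x _ => if_congr (and_iff_left hβ).symm rfl rfl
  · simp [hβ]

theorem totalPayoff_accept_congr {h pts : List (Cube n)} {a : List Bool → Bool} (σ : B ≃ B)
    (hσ : ∀ β, ∀ x ∈ h ++ pts, g β x = f (σ β) x) :
    totalPayoff f (fun β => acceptPayoff (f β)) (.query pts a) h =
      totalPayoff g (fun β => acceptPayoff (g β)) (.query pts a) h := by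
  simp only [totalPayoff, expectedPayoff, acceptPayoff, sum_filter]
  rw [← σ.sum_comp]
  refine sum_congr rfl fun β _ => ?_
  have hqueries : pts.map (g β) = pts.map (f (σ β)) :=
    List.map_congr_left fun x hx => hσ β x (List.mem_append_right _ hx)
  have hsamples : (∀ x ∈ h, f (σ β) x = true) ↔ ∀ x ∈ h, g β x = true :=
    forall₂_congr fun x hx => by rw [hσ β x (List.mem_append_left _ hx)]
  simp only [hqueries, hsamples]

variable {Bad : List (Cube n) → Prop} [DecidablePred Bad]

theorem totalPayoff_accept_le (hf : ∀ β, #(satSet (f β)) = Z) (hg : ∀ β, #(satSet (g β)) = Z)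
    (hBad : ∀ pts, ¬ Bad pts → ∃ σ : B ≃ B, ∀ β, ∀ x ∈ pts, g β x = f (σ β) x)
    (A : NonadaptiveAlg n) (h : List (Cube n)) :
    totalPayoff f (fun β => acceptPayoff (f β)) A h ≤
      totalPayoff g (fun β => acceptPayoff (g β)) A h +
        totalPayoff f (fun _ h pts _ => if Bad (h ++ pts) then 1 else 0) A h := by
  induction A generalizing h with
  | query pts a =>
    by_cases hbad : Bad (h ++ pts)
    · refine le_add_of_nonneg_of_le (sum_nonneg fun β _ => acceptPayoff_nonneg _ h pts a)
        (sum_le_sum fun β _ => ?_)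
      simpa only [expectedPayoff, if_pos hbad] using acceptPayoff_le_one (f β) h pts a
    · obtain ⟨σ, hσ⟩ := hBad _ hbad
      rw [totalPayoff_accept_congr σ hσ]
      exact le_add_of_nonneg_right (sum_nonneg fun β _ => by simp [expectedPayoff, hbad])
  | sample next ih =>
    rw [totalPayoff_sample hf, totalPayoff_sample hg, totalPayoff_sample hf, ← add_div,
      ← sum_add_distrib]
    gcongr with x
    exact ih x _

theorem sum_acceptProb_le (hf : ∀ β, #(satSet (f β)) = Z) (hg : ∀ β, #(satSet (g β)) = Z)
    (hBad : ∀ pts, ¬ Bad pts → ∃ σ : B ≃ B, ∀ β, ∀ x ∈ pts, g β x = f (σ β) x)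
    (A : NonadaptiveAlg n) :
    ∑ β, acceptProb (f β) A ≤ ∑ β, acceptProb (g β) A +
      ∑ β, expectedPayoff (f β) (fun h pts _ => if Bad (h ++ pts) then 1 else 0) A [] := by
  simpa only [totalPayoff_nil, acceptProb] using totalPayoff_accept_le hf hg hBad A []

end Coupling

section Payloads

variable {n : ℕ} {μ φ ι : Type*} [Fintype μ] [DecidableEq μ]

/-- The unate function: on each term it depends only on the flags. -/
noncomputable def constantOnTerms (L : Layout μ φ n) (k : ℕ) (R : Finset ι) (T : ι → Finset μ)
    (β : ι → Bool) : Cube n → Bool :=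
  truncatedTalagrand L k R T fun j _ => β j

/-- The function far from unate: on the term `j` its payload is the literal of the variable `v j`
with the sign given by `β j`. -/
noncomputable def literalOnTerms (L : Layout μ φ n) (k : ℕ) (R : Finset ι) (T : ι → Finset μ)
    (v : ι → μ) (β : ι → Bool) : Cube n → Bool :=
  truncatedTalagrand L k R T fun j X => xor (β j) (decide (v j ∈ X))

/-- The variables in which two members of `S` that satisfy the term `τ` differ. -/
def separated (S : Finset (Finset μ)) (τ : Finset μ) : Finset μ :=
  {i | ∃ X ∈ S, ∃ Y ∈ S, τ ⊆ X ∧ τ ⊆ Y ∧ i ∈ X ∧ i ∉ Y}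

theorem mem_separated {S : Finset (Finset μ)} {τ : Finset μ} {i : μ} :
    i ∈ separated S τ ↔ ∃ X ∈ S, ∃ Y ∈ S, τ ⊆ X ∧ τ ⊆ Y ∧ i ∈ X ∧ i ∉ Y := by
  simp [separated]

/-- The main parts, up to level `k`, of the given points. -/
def Layout.seenSets (L : Layout μ φ n) (k : ℕ) (pts : List (Cube n)) : Finset (Finset μ) :=
  {X ∈ (pts.map L.ones).toFinset | #X ≤ k}

variable {L : Layout μ φ n} {k : ℕ} {R : Finset ι} {T : ι → Finset μ} {v : ι → μ}
  {pts : List (Cube n)}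

theorem Layout.mem_seenSets {X : Finset μ} :
    X ∈ L.seenSets k pts ↔ (∃ u ∈ pts, L.ones u = X) ∧ #X ≤ k := by
  simp [seenSets]

theorem Layout.card_seenSets_le : #(L.seenSets k pts) ≤ pts.length :=
  (card_filter_le _ _).trans ((List.toFinset_card_le _).trans_eq (List.length_map _))

theorem exists_sign_eq_decide_mem {S : Finset (Finset μ)} {τ : Finset μ} {i : μ}
    (hi : i ∉ separated S τ) : ∃ b : Bool, ∀ X ∈ S, τ ⊆ X → decide (i ∈ X) = b := by
  by_cases h : ∃ X ∈ S, τ ⊆ X ∧ i ∈ X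
  · obtain ⟨X, hX, hτX, hiX⟩ := h
    refine ⟨true, fun Y hY hτY => decide_eq_true ?_⟩
    by_contra hiY
    exact hi (mem_separated.2 ⟨X, hX, Y, hY, hτX, hτY, hiX, hiY⟩)
  · exact ⟨false, fun Y hY hτY => decide_eq_false fun hiY => h ⟨Y, hY, hτY, hiY⟩⟩

theorem exists_literalOnTerms_eq_constantOnTerms
    (h : ∀ j, v j ∉ separated (L.seenSets k pts) (T j)) :
    ∃ σ : (ι → Bool) ≃ (ι → Bool), ∀ β, ∀ u ∈ pts,
      literalOnTerms L k R T v β u = constantOnTerms L k R T (σ β) u := by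
  choose c hc using fun j => exists_sign_eq_decide_mem (h j)
  have hinv : Function.Involutive fun (β : ι → Bool) j => xor (β j) (c j) := fun β => by simp
  refine ⟨hinv.toPerm, fun β u hu => ?_⟩
  rw [Bool.eq_iff_iff, literalOnTerms, constantOnTerms, truncatedTalagrand_eq_true,
    truncatedTalagrand_eq_true]
  refine and_congr_right fun _ => and_congr_right fun hk => and_congr_right fun _ =>
    or_congr_right (or_congr_right (or_congr_right (exists_congr fun j =>
      and_congr_right fun hj => ?_)))
  have hTj : T j ⊆ L.ones u := (mem_satisfied.1 (hj ▸ mem_singleton_self j)).2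
  simp only [Function.Involutive.coe_toPerm,
    hc j _ (Layout.mem_seenSets.2 ⟨⟨u, hu, rfl⟩, hk⟩) hTj]

open Classical in
/-- The indicator that some term `T j` is satisfied by two seen points, of level at most `k`, which
differ in the variable `v j`. Only in this event can constant and literal payloads be told
apart. -/
noncomputable def separationPayoff (L : Layout μ φ n) (k : ℕ) (T : ι → Finset μ) (v : ι → μ) :
    Payoff n :=
  fun h pts _ => if ∃ j, v j ∈ separated (L.seenSets k (h ++ pts)) (T j) then 1 else 0

theorem separationPayoff_nonneg (h pts a) : 0 ≤ separationPayoff L k T v h pts a := by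
  rw [separationPayoff]
  positivity

theorem sum_acceptProb_constantOnTerms_le [Fintype ι] [DecidableEq ι] (A : NonadaptiveAlg n) :
    ∑ β, acceptProb (constantOnTerms L k R T β) A ≤
      ∑ β, acceptProb (literalOnTerms L k R T v β) A +
        ∑ β, expectedPayoff (constantOnTerms L k R T β) (separationPayoff L k T v) A [] := by
  let Bad (pts : List (Cube n)) : Prop := ∃ j, v j ∈ separated (L.seenSets k pts) (T j)
  let _ : DecidablePred Bad := Classical.decPred Bad
  exact sum_acceptProb_le (Bad := Bad) (f := constantOnTerms L k R T)
    (g := literalOnTerms L k R T v)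
    (fun _ => card_satSet_truncatedTalagrand_congr _ fun _ _ => false)
    (fun _ => card_satSet_truncatedTalagrand_congr _ _)
    (fun _ h => exists_literalOnTerms_eq_constantOnTerms (not_exists.1 h)) A

end Payloads

/-! ### Random terms -/

section RandomTerms

theorem two_mul_choose_le_succ_choose {l t : ℕ} (h : l + 1 ≤ 2 * t) :
    2 * l.choose t ≤ (l + 1).choose t := by
  obtain hlt | htl := Nat.lt_or_ge l t
  · simp [Nat.choose_eq_zero_of_lt hlt]
  refine Nat.le_of_mul_le_mul_right ?_ (show 0 < l + 1 - t by lia)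
  calc 2 * l.choose t * (l + 1 - t) = l.choose t * (2 * (l + 1 - t)) := by ring
    _ ≤ l.choose t * (l + 1) := by gcongr; lia
    _ = (l + 1).choose t * (l + 1 - t) := Nat.choose_mul_succ_eq l t

theorem two_pow_mul_choose_le {l r t : ℕ} (h : l + r ≤ 2 * t) :
    2 ^ r * l.choose t ≤ (l + r).choose t := by
  induction r with
  | zero => simp
  | succ r ih =>
    calc 2 ^ (r + 1) * l.choose t = 2 * (2 ^ r * l.choose t) := by ring
      _ ≤ 2 * (l + r).choose t := by gcongr; exact ih (by lia)
      _ ≤ (l + (r + 1)).choose t := two_mul_choose_le_succ_choose h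

theorem termProb_pos {m k t : ℕ} (hk : t ≤ k) (hm : t ≤ m) : 0 < termProb m k t :=
  div_pos (by exact_mod_cast Nat.choose_pos hk) (by exact_mod_cast Nat.choose_pos hm)

theorem termProb_mono {m k k' t : ℕ} (h : k ≤ k') : termProb m k t ≤ termProb m k' t := by
  unfold termProb
  gcongr

theorem two_pow_mul_termProb_le {m k l r t : ℕ} (hk : k ≤ 2 * t) (hl : l + r ≤ k) :
    2 ^ r * termProb m l t ≤ termProb m k t := by
  refine le_trans ?_ (termProb_mono hl)
  rw [termProb, termProb, ← mul_div_assoc]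
  gcongr
  exact_mod_cast two_pow_mul_choose_le (hl.trans hk)

/-- The sets of `t` variables. -/
abbrev Term (μ : Type*) (t : ℕ) : Type _ := {τ : Finset μ // #τ = t}

section Expect

variable {ι α : Type*} [Fintype ι] [DecidableEq ι] [Fintype α]

theorem expect_expect_update (j : ι) (F : (ι → α) → ℝ) :
    𝔼 f, 𝔼 a, F (Function.update f j a) = 𝔼 f, F f := by
  obtain hα | hα := isEmpty_or_nonempty α
  · have : IsEmpty (ι → α) := ⟨fun f => hα.elim (f j)⟩
    simp
  have hinv : Function.Involutive fun p : (ι → α) × α => (Function.update p.1 j p.2, p.1 j) :=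
    fun p => by simp
  calc 𝔼 f, 𝔼 a, F (Function.update f j a)
      = 𝔼 p : (ι → α) × α, F (Function.update p.1 j p.2) := by
        rw [← univ_product_univ, expect_product]
    _ = 𝔼 p : (ι → α) × α, F p.1 := Fintype.expect_equiv hinv.toPerm _ _ fun p => rfl
    _ = 𝔼 f, F f := by simp [← univ_product_univ, expect_product]

theorem expect_comp_eval [Nonempty α] (j : ι) (g : α → ℝ) : 𝔼 f : ι → α, g (f j) = 𝔼 a, g a := by
  rw [← expect_expect_update j]
  simp

end Expect

variable {μ : Type*} [Fintype μ] {k r t : ℕ}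

theorem card_term : Fintype.card (Term μ t) = (Fintype.card μ).choose t := by simp

theorem nonempty_term (h : t ≤ Fintype.card μ) : Nonempty (Term μ t) := by
  rw [← Fintype.card_pos_iff, card_term]
  exact Nat.choose_pos h

variable [DecidableEq μ]

theorem card_filter_term_subset (X : Finset μ) : #{τ : Term μ t | τ.1 ⊆ X} = (#X).choose t := by
  rw [← card_powersetCard, ← card_map (Function.Embedding.subtype _)]
  congr 1
  ext τ
  simp [mem_powersetCard, and_comm]

theorem expect_boole_term_subset (X : Finset μ) :
    𝔼 τ : Term μ t, (if τ.1 ⊆ X then 1 else 0 : ℝ) = termProb (Fintype.card μ) #X t := by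
  rw [Fintype.expect_eq_sum_div_card, sum_boole, card_filter_term_subset, card_term, termProb]

theorem card_symmDiff_le_add_ite {X Y : Finset μ} (hX : #X ≤ k) (hY : #Y ≤ k) :
    #(symmDiff X Y) ≤ 2 * r + if #(X ∩ Y) + r ≤ k then Fintype.card μ else 0 := by
  split_ifs with hfar
  · exact le_add_left (card_le_univ _)
  · have hunion : #(symmDiff X Y) ≤ #(X \ Y) + #(Y \ X) := card_union_le _ _
    have hsdiff := card_sdiff_add_card_inter X Y
    have hsdiff' := card_sdiff_add_card_inter Y X
    rw [inter_comm] at hsdiff'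
    lia

theorem separated_subset_biUnion {S : Finset (Finset μ)} {τ X : Finset μ} :
    separated S τ ⊆ {Y ∈ S | τ ⊆ Y}.biUnion (symmDiff X) := by
  intro i hi
  obtain ⟨Y, hY, Z, hZ, hτY, hτZ, hiY, hiZ⟩ := mem_separated.1 hi
  rw [mem_biUnion]
  by_cases hiX : i ∈ X
  · exact ⟨Z, mem_filter.2 ⟨hZ, hτZ⟩, mem_symmDiff.2 (.inl ⟨hiX, hiZ⟩)⟩
  · exact ⟨Y, mem_filter.2 ⟨hY, hτY⟩, mem_symmDiff.2 (.inr ⟨hiY, hiX⟩)⟩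

theorem card_separated_le {S : Finset (Finset μ)} (hS : ∀ X ∈ S, #X ≤ k) (τ : Finset μ) :
    #(separated S τ) ≤ ∑ Y ∈ S, (if τ ⊆ Y then 1 else 0) * (2 * r) +
      ∑ X ∈ S, ∑ Y ∈ S with #(X ∩ Y) + r ≤ k,
        (if τ ⊆ X ∩ Y then 1 else 0) * Fintype.card μ := by
  by_cases hne : ∃ X ∈ S, τ ⊆ X
  · obtain ⟨X, hX, hτX⟩ := hne
    have hY (Y) (hY : Y ∈ {Y ∈ S | τ ⊆ Y}) :
        #(symmDiff X Y) ≤ 2 * r + if #(X ∩ Y) + r ≤ k then Fintype.card μ else 0 :=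
      card_symmDiff_le_add_ite (hS X hX) (hS Y (mem_filter.1 hY).1)
    refine (card_le_card separated_subset_biUnion).trans
      ((card_biUnion_le.trans (sum_le_sum hY)).trans ?_)
    rw [sum_add_distrib, sum_filter]
    gcongr with Y
    · split_ifs <;> simp
    · refine le_trans ?_ (single_le_sum (fun _ _ => Nat.zero_le _) hX)
      rw [sum_filter, sum_filter]
      gcongr with Y
      simp only [subset_inter_iff, hτX, true_and]
      split_ifs <;> simp
  · have hempty : separated S τ = ∅ := eq_empty_of_forall_notMem fun i hi => by
      obtain ⟨X, hX, -, -, hτX, -⟩ := mem_separated.1 hi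
      exact hne ⟨X, hX, hτX⟩
    simp [hempty]

theorem expect_card_separated_le {S : Finset (Finset μ)} (hS : ∀ X ∈ S, #X ≤ k)
    (hk : k ≤ 2 * t) (hr : #S * Fintype.card μ ≤ 2 ^ r) :
    𝔼 τ : Term μ t, (#(separated S τ.1) : ℝ) ≤
      termProb (Fintype.card μ) k t * (#S * (2 * r + 1)) := by
  set m := Fintype.card μ
  set p := termProb m k t
  have hnear (Y) (hY : Y ∈ S) : termProb m #Y t * (2 * r) ≤ p * (2 * r) := by
    gcongr
    exact termProb_mono (hS Y hY)
  have hfar (X : Finset μ) :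
      ∑ Y ∈ S with #(X ∩ Y) + r ≤ k, termProb m #(X ∩ Y) t * m ≤ p := by
    refine le_of_mul_le_mul_left ?_ (show (0 : ℝ) < 2 ^ r by positivity)
    calc 2 ^ r * ∑ Y ∈ S with #(X ∩ Y) + r ≤ k, termProb m #(X ∩ Y) t * m
        = ∑ Y ∈ S with #(X ∩ Y) + r ≤ k, 2 ^ r * termProb m #(X ∩ Y) t * m := by
          simp only [mul_sum, mul_assoc]
      _ ≤ ∑ Y ∈ S with #(X ∩ Y) + r ≤ k, p * m := by
          gcongr with Y hY
          exact two_pow_mul_termProb_le hk (mem_filter.1 hY).2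
      _ ≤ #S * (p * m) := by
          rw [sum_const, nsmul_eq_mul]
          gcongr
          · exact mul_nonneg (termProb_nonneg _ _ _) (Nat.cast_nonneg _)
          · exact filter_subset _ _
      _ = (#S * m) * p := by ring
      _ ≤ 2 ^ r * p := by
          gcongr
          · exact termProb_nonneg _ _ _
          · exact_mod_cast hr
  calc 𝔼 τ : Term μ t, (#(separated S τ.1) : ℝ)
      ≤ 𝔼 τ : Term μ t, (∑ Y ∈ S, (if τ.1 ⊆ Y then 1 else 0) * (2 * r : ℝ) +
        ∑ X ∈ S, ∑ Y ∈ S with #(X ∩ Y) + r ≤ k, (if τ.1 ⊆ X ∩ Y then 1 else 0) * (m : ℝ)) :=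
        expect_le_expect fun τ _ => by exact_mod_cast card_separated_le hS τ.1
    _ = ∑ Y ∈ S, termProb m #Y t * (2 * r) +
        ∑ X ∈ S, ∑ Y ∈ S with #(X ∩ Y) + r ≤ k, termProb m #(X ∩ Y) t * m := by
        simp only [expect_add_distrib, expect_sum_comm, ← expect_mul, expect_boole_term_subset, m]
    _ ≤ ∑ _ ∈ S, p * (2 * r) + ∑ _ ∈ S, p :=
        add_le_add (sum_le_sum hnear) (sum_le_sum fun X _ => hfar X)
    _ = p * (#S * (2 * r + 1)) := by simp only [sum_const, nsmul_eq_mul]; ring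

end RandomTerms

/-! ### Leaving one term out -/

section LeaveOneOut

variable {n : ℕ} {μ φ ι : Type*} [Fintype μ] [DecidableEq μ] [Fintype ι] [DecidableEq ι]
  {L : Layout μ φ n} {k q r t : ℕ} {β : ι → Bool} {A : NonadaptiveAlg n}

theorem expectedPayoff_constantOnTerms_le_erase {T : ι → Finset μ} {j : ι}
    (hm : 3 * k ≤ Fintype.card μ) (hj : #(T j) < k) {G : Payoff n}
    (hG : ∀ h pts a, 0 ≤ G h pts a) (hA : A.MakesAtMost q) :
    expectedPayoff (constantOnTerms L k univ T β) G A [] ≤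
      (1 + 4 * termProb (Fintype.card μ) k #(T j)) ^ q *
        expectedPayoff (constantOnTerms L k (univ.erase j) T β) G A [] := by
  have hp := termProb_nonneg (Fintype.card μ) k #(T j)
  refine expectedPayoff_le_pow_mul satSet_truncatedTalagrand_nonempty (fun u hu => ?_)
    (by linarith) (card_satSet_erase_le hm hj) hG A q hA []
  exact mem_satSet_truncatedTalagrand.2
    ((mem_satSet_truncatedTalagrand.1 hu).mono (erase_subset j univ))

theorem expect_card_separated_seenSets_le (hk : k ≤ 2 * t) (hr : q * Fintype.card μ ≤ 2 ^ r)
    {pts : List (Cube n)} (hpts : pts.length ≤ q) :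
    𝔼 τ : Term μ t, (#(separated (L.seenSets k pts) τ.1) : ℝ) / Fintype.card μ ≤
      termProb (Fintype.card μ) k t * (q * (2 * r + 1)) / Fintype.card μ := by
  have hseen : #(L.seenSets k pts) ≤ q := Layout.card_seenSets_le.trans hpts
  rw [← expect_div]
  gcongr
  refine (expect_card_separated_le (fun X hX => (Layout.mem_seenSets.1 hX).2) hk
    ((Nat.mul_le_mul_right _ hseen).trans hr)).trans ?_
  have hp := termProb_nonneg (Fintype.card μ) k t
  gcongr

theorem expect_expectedPayoff_card_separated_le (hm : 3 * k ≤ Fintype.card μ) (ht : t < k)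
    (hk : k ≤ 2 * t) (hr : q * Fintype.card μ ≤ 2 ^ r) (hA : A.MakesAtMost q) (j : ι) :
    𝔼 T : ι → Term μ t, expectedPayoff (constantOnTerms L k univ (fun i => (T i).1) β)
        (fun h pts _ => #(separated (L.seenSets k (h ++ pts)) (T j).1) / Fintype.card μ) A [] ≤
      (1 + 4 * termProb (Fintype.card μ) k t) ^ q *
        (termProb (Fintype.card μ) k t * (q * (2 * r + 1)) / Fintype.card μ) := by
  have hp : 0 ≤ termProb (Fintype.card μ) k t := termProb_nonneg _ _ _
  let payoff (τ : Term μ t) : Payoff n :=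
    fun h pts _ => #(separated (L.seenSets k (h ++ pts)) τ.1) / Fintype.card μ
  let without (T : ι → Term μ t) : Cube n → Bool :=
    constantOnTerms L k (univ.erase j) (fun i => (T i).1) β
  have without_update (T : ι → Term μ t) (τ : Term μ t) :
      without (Function.update T j τ) = without T :=
    truncatedTalagrand_congr fun i hi => by rw [Function.update_of_ne (ne_of_mem_erase hi)]
  have hfresh (T : ι → Term μ t) :
      𝔼 τ, expectedPayoff (without T) (payoff τ) A [] ≤
        termProb (Fintype.card μ) k t * (q * (2 * r + 1)) / Fintype.card μ := by
    rw [← expectedPayoff_expect]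
    refine expectedPayoff_le_of_le (Q := q) satSet_truncatedTalagrand_nonempty
      (fun h pts _ hQ => ?_) A q hA [] (by simp)
    exact expect_card_separated_seenSets_le hk hr (by rwa [List.length_append])
  have hdrop (T : ι → Term μ t) :
      expectedPayoff (constantOnTerms L k univ (fun i => (T i).1) β) (payoff (T j)) A [] ≤
        (1 + 4 * termProb (Fintype.card μ) k t) ^ q *
          expectedPayoff (without T) (payoff (T j)) A [] := by
    have hle := expectedPayoff_constantOnTerms_le_erase (L := L) (β := β) (j := j)
      (T := fun i => (T i).1) hm ((T j).2.trans_lt ht) (G := payoff (T j))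
      (fun _ _ _ => div_nonneg (Nat.cast_nonneg _) (Nat.cast_nonneg _)) hA
    rwa [(T j).2] at hle
  refine (expect_le_expect fun T _ => hdrop T).trans ?_
  rw [← mul_expect, ← expect_expect_update j]
  simp only [without_update, Function.update_self]
  gcongr
  have : Nonempty (Term μ t) := nonempty_term (by lia)
  exact expect_le univ_nonempty fun T _ => hfresh T

theorem expect_separationPayoff_le [Nonempty μ] (T : ι → Finset μ) (h pts a) :
    𝔼 v, separationPayoff L k T v h pts a ≤
      ∑ j, (#(separated (L.seenSets k (h ++ pts)) (T j)) : ℝ) / Fintype.card μ := by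
  have hunion (v : ι → μ) : separationPayoff L k T v h pts a ≤
      ∑ j, if v j ∈ separated (L.seenSets k (h ++ pts)) (T j) then 1 else 0 := by
    rw [separationPayoff]
    split_ifs with hbad
    · obtain ⟨j, hj⟩ := hbad
      refine le_trans (by rw [if_pos hj]) (single_le_sum (fun i _ => ?_) (mem_univ j))
      positivity
    · positivity
  refine (expect_le_expect fun v _ => hunion v).trans_eq ?_
  rw [expect_sum_comm]
  refine sum_congr rfl fun j _ => ?_
  rw [expect_comp_eval j fun i =>
    if i ∈ separated (L.seenSets k (h ++ pts)) (T j) then (1 : ℝ) else 0]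
  simp [Fintype.expect_eq_sum_div_card]

theorem expect_expect_expectedPayoff_separationPayoff_le (hm : 3 * k ≤ Fintype.card μ)
    (ht : t < k) (hk : k ≤ 2 * t) (hr : q * Fintype.card μ ≤ 2 ^ r) (hA : A.MakesAtMost q) :
    𝔼 T : ι → Term μ t, 𝔼 v : ι → μ,
        expectedPayoff (constantOnTerms L k univ (fun i => (T i).1) β)
          (separationPayoff L k (fun i => (T i).1) v) A [] ≤
      Fintype.card ι * ((1 + 4 * termProb (Fintype.card μ) k t) ^ q *
        (termProb (Fintype.card μ) k t * (q * (2 * r + 1)) / Fintype.card μ)) := by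
  have : Nonempty μ := Fintype.card_pos_iff.1 (by lia)
  let f (T : ι → Term μ t) : Cube n → Bool := constantOnTerms L k univ (fun i => (T i).1) β
  calc 𝔼 T : ι → Term μ t, 𝔼 v : ι → μ,
          expectedPayoff (f T) (separationPayoff L k (fun i => (T i).1) v) A []
      ≤ 𝔼 T : ι → Term μ t, ∑ j, expectedPayoff (f T) (fun h pts _ =>
          #(separated (L.seenSets k (h ++ pts)) (T j).1) / Fintype.card μ) A [] := by
        refine expect_le_expect fun T _ => ?_
        rw [← expectedPayoff_expect, ← expectedPayoff_sum]
        exact expectedPayoff_mono (expect_separationPayoff_le _) A []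
    _ = ∑ j, 𝔼 T : ι → Term μ t, expectedPayoff (f T) (fun h pts _ =>
          #(separated (L.seenSets k (h ++ pts)) (T j).1) / Fintype.card μ) A [] :=
        expect_sum_comm _ _ _
    _ ≤ Fintype.card ι • ((1 + 4 * termProb (Fintype.card μ) k t) ^ q *
          (termProb (Fintype.card μ) k t * (q * (2 * r + 1)) / Fintype.card μ)) :=
        sum_le_card_nsmul _ _ _ fun j _ =>
          expect_expectedPayoff_card_separated_le hm ht hk hr hA j
    _ = _ := nsmul_eq_mul _ _

end LeaveOneOut

/-! ### Distance from unate functions -/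

section Distance

variable {n : ℕ}

theorem mem_symmDiff_satSet {f g : Cube n → Bool} {u : Cube n} :
    u ∈ symmDiff (satSet f) (satSet g) ↔ f u ≠ g u := by
  simp only [mem_symmDiff, satSet, mem_filter, mem_univ, true_and]
  cases f u <;> cases g u <;> simp

theorem mem_symmDiff_satSet_or_of_le {f g : Cube n → Bool} {u w : Cube n} (hg : g u ≤ g w)
    (hu : f u = true) (hw : f w = false) :
    u ∈ symmDiff (satSet f) (satSet g) ∨ w ∈ symmDiff (satSet f) (satSet g) := by
  rw [mem_symmDiff_satSet, mem_symmDiff_satSet, hu, hw]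
  revert hg
  cases g u <;> cases g w <;> simp

theorem eq_of_update_true_eq {u w : Cube n} {i : Fin n} (hu : u i = false) (hw : w i = false)
    (h : Function.update u i true = Function.update w i true) : u = w := by
  ext x
  obtain rfl | hx := eq_or_ne x i
  · rw [hu, hw]
  · simpa [hx] using congrFun h x

theorem card_le_two_mul_of_forall_or {α : Type*} {U S : Finset α}
    {r : α → α → Prop} (hr : ∀ u ∈ U, ∀ u' ∈ U, ∀ w, r u w → r u' w → u = u')
    (h : ∀ u ∈ U, u ∈ S ∨ ∃ w ∈ S, r u w) : #U ≤ 2 * #S := by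
  classical
  have hmatched : #(U \ S) ≤ #S := card_le_card_of_forall_subsingleton r
    (fun u hu => (h u (mem_sdiff.1 hu).1).resolve_left (mem_sdiff.1 hu).2)
    (fun w _ u hu u' hu' => hr u (mem_sdiff.1 hu.1).1 u' (mem_sdiff.1 hu'.1).1 w hu.2 hu'.2)
  have hinter : #(U ∩ S) ≤ #S := card_le_card inter_subset_right
  have := card_sdiff_add_card_inter U S
  lia

theorem choose_succ_le_two_mul_choose {m k : ℕ} (h : 2 * k ≤ m + 1) :
    (m + 1).choose k ≤ 2 * m.choose k := by
  refine Nat.le_of_mul_le_mul_right ?_ m.succ_pos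
  calc (m + 1).choose k * (m + 1) ≤ (m + 1).choose k * (2 * (m + 1 - k)) := by gcongr; lia
    _ = 2 * ((m + 1).choose k * (m + 1 - k)) := by ring
    _ = 2 * m.choose k * (m + 1) := by rw [← Nat.choose_mul_succ_eq, mul_assoc]

theorem unate_nonempty (n : ℕ) : (unate n).Nonempty :=
  ⟨fun _ => false, fun _ => .inl fun _ => le_rfl⟩

variable {μ φ ι : Type*} [DecidableEq μ] {T : ι → Finset μ} {v : ι → μ} {X : Finset μ} {j : ι}

/-- Both `X` and `insert (v j) X` satisfy the term `j` and no other term, and `v j ∉ X`. -/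
def IsCriticalFor (T : ι → Finset μ) (v : ι → μ) (X : Finset μ) (j : ι) : Prop :=
  T j ⊆ X ∧ v j ∉ X ∧ ∀ j' ≠ j, ¬ T j' ⊆ insert (v j) X

theorem IsCriticalFor.satisfied_insert [Fintype ι] (h : IsCriticalFor T v X j) :
    satisfied univ T (insert (v j) X) = {j} := by
  ext i
  rw [mem_satisfied, mem_singleton]
  refine ⟨fun hi => by_contra fun hij => h.2.2 i hij hi.2, ?_⟩
  rintro rfl
  exact ⟨mem_univ _, h.1.trans (subset_insert _ _)⟩

theorem IsCriticalFor.satisfied [Fintype ι] (h : IsCriticalFor T v X j) :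
    satisfied univ T X = {j} := by
  refine (subset_singleton_iff.1 (h.satisfied_insert ▸
    satisfied_mono (subset_insert _ _))).resolve_left (ne_empty_of_mem (a := j) ?_)
  exact mem_satisfied.2 ⟨mem_univ j, h.1⟩

variable [Fintype μ] {L : Layout μ φ n} {k : ℕ}

theorem le_card_symmDiff_of_oneMonotoneIn [Fintype φ] {R : Finset ι}
    {pay : ι → Finset μ → Bool} (h : 3 * k ≤ Fintype.card μ) {g : Cube n → Bool} {i : μ}
    (hg : OneMonotoneIn g (L.main i)) :
    (Fintype.card μ).choose k * 2 ^ Fintype.card φ ≤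
      4 * #(symmDiff (satSet (truncatedTalagrand L k R T pay)) (satSet g)) := by
  obtain ⟨m, hm⟩ := Nat.exists_eq_succ_of_ne_zero (Fintype.card_pos_iff.2 ⟨i⟩).ne'
  have hcard : #(L.cylinder (fun _ => false) (powersetCard k (univ.erase i))) =
      m.choose k * 2 ^ Fintype.card φ := by
    rw [Layout.card_cylinder, card_powersetCard, card_erase_of_mem (mem_univ i), card_univ, hm,
      Nat.succ_sub_one]
  have hmatch : #(L.cylinder (fun _ => false) (powersetCard k (univ.erase i))) ≤
      2 * #(symmDiff (satSet (truncatedTalagrand L k R T pay)) (satSet g)) := by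
    have main_eq_false {u : Cube n} (hu : L.ones u ∈ powersetCard k (univ.erase i)) :
        u (L.main i) = false := by
      have hi : i ∉ L.ones u := fun hi => notMem_erase i univ ((mem_powersetCard.1 hu).1 hi)
      simpa using hi
    refine card_le_two_mul_of_forall_or (r := fun u w => Function.update u (L.main i) true = w)
      (fun u hu u' hu' w huw hu'w => ?_) (fun u hu => ?_)
    · exact eq_of_update_true_eq (main_eq_false (Layout.mem_cylinder.1 hu).2.2)
        (main_eq_false (Layout.mem_cylinder.1 hu').2.2) (huw.trans hu'w.symm)
    · obtain ⟨hsupp, hflags, hones⟩ := Layout.mem_cylinder.1 hu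
      have hui := main_eq_false hones
      simp only [exists_eq_right']
      refine mem_symmDiff_satSet_or_of_le ?_ ?_ ?_
      · simpa only [← hui, Function.update_eq_self] using hg u
      · exact truncatedTalagrand_eq_true.2 ⟨hsupp, (mem_powersetCard.1 hones).2.le,
          ⟨true, congrFun hflags _⟩, .inl (congrFun hflags)⟩
      · rw [← Bool.not_eq_true, truncatedTalagrand_eq_true]
        rintro ⟨-, hk, -⟩
        rw [Layout.ones_update_main_true, card_insert_of_notMem (by simp [hui]),
          (mem_powersetCard.1 hones).2] at hk
        lia
  calc (Fintype.card μ).choose k * 2 ^ Fintype.card φ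
      ≤ 2 * m.choose k * 2 ^ Fintype.card φ := by
        rw [hm]
        gcongr
        exact choose_succ_le_two_mul_choose (by lia)
    _ = 2 * #(L.cylinder (fun _ => false) (powersetCard k (univ.erase i))) := by
        rw [hcard, mul_assoc]
    _ ≤ _ := by lia

open Classical in
/-- The sets of size `k - 1` that are critical for some term. -/
noncomputable def criticalSets (k : ℕ) (T : ι → Finset μ) (v : ι → μ) : Finset (Finset μ) :=
  {X | #X + 1 = k ∧ ∃ j, IsCriticalFor T v X j}

theorem mem_criticalSets :
    X ∈ criticalSets k T v ↔ #X + 1 = k ∧ ∃ j, IsCriticalFor T v X j := by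
  simp [criticalSets]

theorem IsCriticalFor.eq_of_update_eq {u u' : Cube n} {j j' : ι}
    (hj : IsCriticalFor T v (L.ones u) j) (hj' : IsCriticalFor T v (L.ones u') j')
    (h : Function.update u (L.main (v j)) true = Function.update u' (L.main (v j')) true) :
    u = u' := by
  have hones := congrArg L.ones h
  rw [Layout.ones_update_main_true, Layout.ones_update_main_true] at hones
  obtain rfl : j' = j := by_contra fun hne =>
    hj.2.2 j' hne (hones ▸ hj'.1.trans (subset_insert _ _))
  exact eq_of_update_true_eq (by simpa using hj.2.1) (by simpa using hj'.2.1) h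

variable [Fintype ι] {u : Cube n} {β : ι → Bool}

theorem IsCriticalFor.literalOnTerms_eq_false (hj : IsCriticalFor T v (L.ones u) j)
    (hk : #(L.ones u) + 1 = k) (hflags : L.flags u false = !L.flags u true)
    (hβ : β j = L.flags u true) : literalOnTerms L k univ T v β u = false := by
  rw [← Bool.not_eq_true, literalOnTerms, truncatedTalagrand_eq_true, TruncatedTalagrandSat,
    hj.satisfied]
  rintro ⟨-, -, -, h | h | h | ⟨j', h, hpay⟩⟩
  · simp [h] at hflags
  · lia
  · simp at h
  · obtain rfl := singleton_injective h
    simp [hj.2.1, hβ] at hpay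

theorem IsCriticalFor.literalOnTerms_update_eq_true (hj : IsCriticalFor T v (L.ones u) j)
    (hu : L.Supported u) (hk : #(L.ones u) + 1 = k) (hflags : L.flags u false = !L.flags u true)
    (hβ : β j = L.flags u true) :
    literalOnTerms L k univ T v β (Function.update u (L.main (v j)) true) = true := by
  rw [literalOnTerms, truncatedTalagrand_eq_true, TruncatedTalagrandSat,
    Layout.supported_update_main, Layout.flags_update_main, Layout.ones_update_main_true]
  refine ⟨hu, (card_insert_le _ _).trans hk.le, ?_, .inr (.inr (.inr ⟨j, hj.satisfied_insert, ?_⟩))⟩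
  · rw [Bool.exists_bool, hflags]
    cases L.flags u true <;> simp
  · simp [hβ]

open Classical in
theorem card_criticalSets_filter_mul_le [Fintype φ] {g : Cube n → Bool}
    (hg : ∀ i, ZeroMonotoneIn g (L.main i)) {c : Bool → Bool} (hc : c false = !c true) :
    #{X ∈ criticalSets k T v | ∃ j, IsCriticalFor T v X j ∧ β j = c true} * 2 ^ Fintype.card φ ≤
      2 * #(symmDiff (satSet (literalOnTerms L k univ T v β)) (satSet g)) := by
  rw [← Layout.card_cylinder (L := L) c]
  refine card_le_two_mul_of_forall_or (r := fun u w => ∃ j, IsCriticalFor T v (L.ones u) j ∧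
    Function.update u (L.main (v j)) true = w) ?_ fun u hu => ?_
  · rintro u - u' - w ⟨j, hj, rfl⟩ ⟨j', hj', h⟩
    exact hj.eq_of_update_eq hj' h.symm
  · obtain ⟨hsupp, rfl, hones⟩ := Layout.mem_cylinder.1 hu
    obtain ⟨hcrit, j, hj, hβ⟩ := mem_filter.1 hones
    have hk := (mem_criticalSets.1 hcrit).1
    have hui : u (L.main (v j)) = false := by simpa using hj.2.1
    refine (mem_symmDiff_satSet_or_of_le ?_ (hj.literalOnTerms_update_eq_true hsupp hk hc hβ)
      (hj.literalOnTerms_eq_false hk hc hβ)).symm.imp_right fun h => ⟨_, h, j, hj, rfl⟩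
    simpa only [← hui, Function.update_eq_self] using hg (v j) u

theorem card_criticalSets_mul_le [Fintype φ] {g : Cube n → Bool}
    (hg : ∀ i, ZeroMonotoneIn g (L.main i)) :
    #(criticalSets k T v) * 2 ^ Fintype.card φ ≤
      4 * #(symmDiff (satSet (literalOnTerms L k univ T v β)) (satSet g)) := by
  classical
  set P : Bool → Finset (Finset μ) := fun b =>
    {X ∈ criticalSets k T v | ∃ j, IsCriticalFor T v X j ∧ β j = b} with hP
  have hunion : #(criticalSets k T v) ≤ #(P true) + #(P false) := by
    refine le_trans (card_le_card fun X hX => ?_) (card_union_le _ _)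
    obtain ⟨-, j, hj⟩ := mem_criticalSets.1 hX
    rw [mem_union, hP, mem_filter, mem_filter]
    exact (Bool.eq_false_or_eq_true (β j)).imp (⟨hX, j, hj, ·⟩) (⟨hX, j, hj, ·⟩)
  have hpos := card_criticalSets_filter_mul_le (k := k) (T := T) (v := v) (β := β) hg (c := id) rfl
  have hneg := card_criticalSets_filter_mul_le (k := k) (T := T) (v := v) (β := β) hg (c := not) rfl
  calc #(criticalSets k T v) * 2 ^ Fintype.card φ
      ≤ (#(P true) + #(P false)) * 2 ^ Fintype.card φ := by gcongr
    _ = #(P true) * 2 ^ Fintype.card φ + #(P false) * 2 ^ Fintype.card φ := add_mul _ _ _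
    _ ≤ _ := by
      have := add_le_add hpos hneg
      rw [hP]
      simp only [id_eq, Bool.not_true] at this
      lia

theorem le_relDistTo_unate (h : 3 * k ≤ Fintype.card μ)
    (hcrit : (Fintype.card μ).choose k ≤ 144 * #(criticalSets k T v)) :
    1 / 3456 ≤ relDistTo (literalOnTerms L k univ T v β) (unate n) := by
  have := L.finite_free
  have := Fintype.ofFinite φ
  refine le_csInf ((unate_nonempty n).image _) ?_
  rintro _ ⟨g, hg, rfl⟩
  have hfar : (Fintype.card μ).choose k * 2 ^ Fintype.card φ ≤
      576 * #(symmDiff (satSet (literalOnTerms L k univ T v β)) (satSet g)) := by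
    by_cases hi : ∃ i, OneMonotoneIn g (L.main i)
    · obtain ⟨i, hi⟩ := hi
      exact (le_card_symmDiff_of_oneMonotoneIn h hi).trans
        (Nat.mul_le_mul_right _ (by norm_num))
    · calc (Fintype.card μ).choose k * 2 ^ Fintype.card φ
          ≤ 144 * #(criticalSets k T v) * 2 ^ Fintype.card φ := by gcongr
        _ = 144 * (#(criticalSets k T v) * 2 ^ Fintype.card φ) := mul_assoc _ _ _
        _ ≤ 144 * (4 * #(symmDiff (satSet (literalOnTerms L k univ T v β)) (satSet g))) := by
          refine Nat.mul_le_mul_left _ ?_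
          exact card_criticalSets_mul_le fun i => (hg (L.main i)).resolve_left fun h => hi ⟨i, h⟩
        _ = _ := by ring
  have hsize : #(satSet (literalOnTerms L k univ T v β)) ≤
      3456 * #(symmDiff (satSet (literalOnTerms L k univ T v β)) (satSet g)) :=
    (card_satSet_le h).trans (by lia)
  have hpos : 0 < #(satSet (literalOnTerms L k univ T v β)) :=
    satSet_truncatedTalagrand_nonempty.card_pos
  rw [relDist, le_div_iff₀ (by exact_mod_cast hpos), one_div_mul_eq_div,
    div_le_iff₀ (by norm_num), mul_comm]
  exact_mod_cast hsize

end Distance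

/-! ### Critical sets of random terms -/

section RandomCriticalSets

theorem expect_prod_apply {ι α : Type*} [Fintype ι] [DecidableEq ι] [Fintype α] (F : ι → α → ℝ) :
    𝔼 f : ι → α, ∏ i, F i (f i) = ∏ i, 𝔼 a, F i a := by
  simp only [Fintype.expect_eq_sum_div_card, prod_div_distrib, prod_univ_sum,
    Fintype.piFinset_univ, prod_const, Fintype.card_fun, Nat.cast_pow, card_univ]

theorem expect_boole_notMem {μ : Type*} [Fintype μ] [DecidableEq μ] [Nonempty μ] (X : Finset μ) :
    𝔼 a, (if a ∉ X then 1 else 0 : ℝ) = 1 - #X / Fintype.card μ := by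
  have hμ : (Fintype.card μ : ℝ) ≠ 0 := by exact_mod_cast Fintype.card_ne_zero
  rw [Fintype.expect_eq_sum_div_card, sum_boole, filter_notMem_eq_sdiff, ← compl_eq_univ_sdiff,
    card_compl, Nat.cast_sub (card_le_univ X), sub_div, div_self hμ]

variable {μ ι : Type*} [Fintype μ] [DecidableEq μ] {k t : ℕ}

theorem card_criticalSets_le (T : ι → Finset μ) (v : ι → μ) :
    #(criticalSets (k + 1) T v) ≤ (Fintype.card μ).choose k := by
  rw [← card_univ, ← card_powersetCard]
  refine card_le_card fun X hX => mem_powersetCard.2 ⟨subset_univ X, ?_⟩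
  exact Nat.succ_injective (mem_criticalSets.1 hX).1

variable [Fintype ι]

open Classical in
theorem card_criticalSets (k : ℕ) (T : ι → Finset μ) (v : ι → μ) :
    #(criticalSets k T v) =
      ∑ X ∈ {X : Finset μ | #X + 1 = k}, ∑ j, if IsCriticalFor T v X j then 1 else 0 := by
  rw [criticalSets, ← filter_filter, card_filter]
  refine sum_congr rfl fun X _ => ?_
  split_ifs with h
  · obtain ⟨j, hj⟩ := h
    have heq (i) (hi : IsCriticalFor T v X i) : i = j :=
      singleton_injective (hi.satisfied.symm.trans hj.satisfied)
    rw [sum_eq_single j (fun i _ hij => if_neg fun hi => hij (heq i hi)) (by simp), if_pos hj]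
  · exact (sum_eq_zero fun j _ => if_neg fun hj => h ⟨j, hj⟩).symm

variable [DecidableEq ι]

open Classical in
theorem expect_boole_isCriticalFor (ht : t ≤ Fintype.card μ) {v : ι → μ} {X : Finset μ} {j : ι}
    (hv : v j ∉ X) :
    𝔼 T : ι → Term μ t, (if IsCriticalFor (fun i => (T i).1) v X j then 1 else 0 : ℝ) =
      termProb (Fintype.card μ) #X t *
        (1 - termProb (Fintype.card μ) (#X + 1) t) ^ (Fintype.card ι - 1) := by
  have : Nonempty (Term μ t) := nonempty_term ht
  let P (i : ι) (τ : Term μ t) : Prop := if i = j then τ.1 ⊆ X else ¬ τ.1 ⊆ insert (v j) X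
  have hcrit (T : ι → Term μ t) :
      IsCriticalFor (fun i => (T i).1) v X j ↔ ∀ i, P i (T i) := by
    refine ⟨fun h i => ?_, fun h => ⟨by simpa [P] using h j, hv, fun i hi => ?_⟩⟩
    · obtain rfl | hi := eq_or_ne i j
      · simpa [P] using h.1
      · simpa [P, hi] using h.2.2 i hi
    · simpa [P, hi] using h i
  have hPj : 𝔼 τ, (if P j τ then 1 else 0 : ℝ) = termProb (Fintype.card μ) #X t := by
    simp only [P, if_true, expect_boole_term_subset]
  have hP (i) (hi : i ∈ univ.erase j) : 𝔼 τ, (if P i τ then 1 else 0 : ℝ) =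
      1 - termProb (Fintype.card μ) (#X + 1) t := by
    have hnot (τ : Term μ t) : (if P i τ then 1 else 0 : ℝ) =
        1 - if τ.1 ⊆ insert (v j) X then 1 else 0 := by
      by_cases h : τ.1 ⊆ insert (v j) X <;> simp [P, ne_of_mem_erase hi, h]
    simp only [hnot, expect_sub_distrib, expect_boole_term_subset, card_insert_of_notMem hv,
      Fintype.expect_const]
  simp only [hcrit, ← Fintype.prod_boole]
  rw [expect_prod_apply fun i (τ : Term μ t) => if P i τ then (1 : ℝ) else 0,
    ← mul_prod_erase _ _ (mem_univ j), hPj, prod_congr rfl hP, prod_const,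
    card_erase_of_mem (mem_univ j), card_univ]

open Classical in
theorem expect_expect_boole_isCriticalFor [Nonempty μ] (ht : t ≤ Fintype.card μ) (X : Finset μ)
    (j : ι) :
    𝔼 T : ι → Term μ t, 𝔼 v : ι → μ,
        (if IsCriticalFor (fun i => (T i).1) v X j then 1 else 0 : ℝ) =
      (1 - #X / Fintype.card μ) * (termProb (Fintype.card μ) #X t *
        (1 - termProb (Fintype.card μ) (#X + 1) t) ^ (Fintype.card ι - 1)) := by
  rw [expect_comm, ← expect_boole_notMem,
    ← expect_comp_eval j fun a => (if a ∉ X then 1 else 0 : ℝ), expect_mul]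
  refine expect_congr rfl fun v _ => ?_
  by_cases hv : v j ∉ X
  · rw [if_pos hv, one_mul, expect_boole_isCriticalFor ht hv]
  · simp [IsCriticalFor, hv]

theorem expect_expect_card_criticalSets [Nonempty μ] (ht : t ≤ Fintype.card μ) :
    𝔼 T : ι → Term μ t, 𝔼 v : ι → μ, (#(criticalSets (k + 1) (fun i => (T i).1) v) : ℝ) =
      (Fintype.card μ).choose k * (Fintype.card ι * ((1 - k / Fintype.card μ) *
        (termProb (Fintype.card μ) k t *
          (1 - termProb (Fintype.card μ) (k + 1) t) ^ (Fintype.card ι - 1)))) := by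
  classical
  simp only [card_criticalSets, Nat.cast_sum, Nat.cast_ite, Nat.cast_one, Nat.cast_zero,
    expect_sum_comm, expect_expect_boole_isCriticalFor ht, add_left_inj]
  rw [sum_congr rfl fun X hX => by rw [(mem_filter.1 hX).2]]
  simp only [sum_const, nsmul_eq_mul, card_univ]
  congr 2
  rw [← card_univ, ← card_powersetCard]
  congr 1
  ext X
  simp

theorem expect_le_mul_card_filter_add {I : Type*} [Fintype I] {V : I → ℝ} {b c : ℝ}
    (hb : ∀ i, V i ≤ b) (hc : 0 ≤ c) :
    𝔼 i, V i ≤ b * (#{i | c ≤ V i} / Fintype.card I) + c := by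
  have hV (i : I) : V i ≤ b * (if c ≤ V i then 1 else 0) + c := by
    split_ifs with h
    · linarith [hb i]
    · linarith
  obtain hI | hI := isEmpty_or_nonempty I
  · simpa using hc
  calc 𝔼 i, V i ≤ 𝔼 i, (b * (if c ≤ V i then 1 else 0) + c) := expect_le_expect fun i _ => hV i
    _ = _ := by
      rw [expect_add_distrib, ← mul_expect, Fintype.expect_const, Fintype.expect_eq_sum_div_card,
        sum_boole]

theorem pow_mul_descFactorial_le {c k m : ℕ} (h : c * k ≤ m) (t : ℕ) :
    c ^ t * k.descFactorial t ≤ m.descFactorial t := by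
  induction t with
  | zero => simp
  | succ t ih =>
    have hfactor : c * (k - t) ≤ m - t := by
      obtain rfl | hc := c.eq_zero_or_pos
      · simp
      · rw [Nat.mul_sub]
        exact tsub_le_tsub h (Nat.le_mul_of_pos_left t hc)
    rw [Nat.descFactorial_succ, Nat.descFactorial_succ]
    calc c ^ (t + 1) * ((k - t) * k.descFactorial t)
        = c * (k - t) * (c ^ t * k.descFactorial t) := by ring
      _ ≤ (m - t) * m.descFactorial t := Nat.mul_le_mul hfactor ih

theorem pow_mul_choose_le {c k m : ℕ} (h : c * k ≤ m) (t : ℕ) :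
    c ^ t * k.choose t ≤ m.choose t := by
  refine Nat.le_of_mul_le_mul_left ?_ t.factorial_pos
  rw [mul_left_comm, ← Nat.descFactorial_eq_factorial_mul_choose,
    ← Nat.descFactorial_eq_factorial_mul_choose]
  exact pow_mul_descFactorial_le h t

theorem pow_mul_termProb_le_one {c k m : ℕ} (h : c * k ≤ m) (t : ℕ) :
    c ^ t * termProb m k t ≤ 1 := by
  rw [termProb, ← mul_div_assoc]
  exact div_le_one_of_le₀ (by exact_mod_cast pow_mul_choose_le h t) (Nat.cast_nonneg _)

theorem termProb_le_half {k m t : ℕ} (h : 2 * k ≤ m) (ht : 1 ≤ t) : termProb m k t ≤ 1 / 2 := by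
  have hpow : (2 : ℝ) ≤ 2 ^ t := le_self_pow₀ one_le_two (by lia)
  have hmul := pow_mul_termProb_le_one h t
  have := mul_le_mul_of_nonneg_right hpow (termProb_nonneg m k t)
  push_cast at hmul
  linarith

theorem two_mul_termProb_two_mul_sub_one {t : ℕ} (ht : 1 ≤ t) (m : ℕ) :
    2 * termProb m (2 * t - 1) t = termProb m (2 * t) t := by
  obtain ⟨s, rfl⟩ := Nat.exists_eq_add_of_le' ht
  have hchoose : 2 * (2 * s + 1).choose (s + 1) = (2 * (s + 1)).choose (s + 1) := by
    rw [mul_add_one 2 s, Nat.choose_succ_succ' (2 * s + 1), Nat.choose_symm_half, two_mul]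
  rw [termProb, termProb, ← mul_div_assoc, show 2 * (s + 1) - 1 = 2 * s + 1 by lia]
  congr 1
  exact_mod_cast hchoose

theorem two_mul_choose_le_five_mul_choose {t : ℕ} (ht : 1 ≤ t) :
    2 * (6 * t).choose (2 * t) ≤ 5 * (6 * t).choose (2 * t - 1) := by
  obtain ⟨s, hs⟩ : ∃ s, 2 * t = s + 1 := ⟨2 * t - 1, by lia⟩
  rw [hs, Nat.add_sub_cancel]
  refine Nat.le_of_mul_le_mul_right ?_ s.succ_pos
  calc 2 * (6 * t).choose (s + 1) * (s + 1)
      = (6 * t).choose s * (2 * (6 * t - s)) := by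
        rw [mul_assoc, Nat.choose_succ_right_eq, mul_left_comm]
    _ ≤ (6 * t).choose s * (5 * (s + 1)) := by gcongr 1; lia
    _ = 5 * (6 * t).choose s * (s + 1) := by ring

theorem one_third_le_one_sub_pow {M : ℕ} {p : ℝ} (hp : p ≤ 1 / 2) (hMp : (M + 1) * p ≤ 1) :
    1 / 3 ≤ (1 - p) ^ M := by
  have hpos : 0 < 1 - p := by linarith
  have hinv : (1 - p)⁻¹ ≤ Real.exp (p / (1 - p)) := by
    have := Real.add_one_le_exp (p / (1 - p))
    rwa [div_add_one hpos.ne', add_sub_cancel, one_div] at this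
  have hpow : ((1 - p) ^ M)⁻¹ ≤ 3 := by
    calc ((1 - p) ^ M)⁻¹ ≤ Real.exp (p / (1 - p)) ^ M := by rw [← inv_pow]; gcongr
      _ = Real.exp (M * (p / (1 - p))) := (Real.exp_nat_mul _ _).symm
      _ ≤ Real.exp 1 := by
        rw [Real.exp_le_exp, mul_div_assoc', div_le_one hpos]
        linarith
      _ ≤ 3 := Real.exp_one_lt_three.le
  rwa [inv_le_comm₀ (pow_pos hpos M) three_pos, ← one_div] at hpow

theorem exists_half_le_nat_mul_le_one {p : ℝ} (hp : 0 < p) (hp' : p ≤ 1 / 2) :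
    ∃ M : ℕ, 1 / 2 ≤ M * p ∧ M * p ≤ 1 := by
  have hle := Nat.floor_le (one_div_pos.2 hp).le
  have hlt := Nat.lt_floor_add_one (1 / p)
  rw [le_div_iff₀ hp] at hle
  rw [div_lt_iff₀ hp] at hlt
  exact ⟨⌊1 / p⌋₊, by linarith, hle⟩

theorem choose_div_le_expect_expect_card_criticalSets (ht : 1 ≤ t)
    (hm : Fintype.card μ = 6 * t)
    (hι : 1 / 2 ≤ Fintype.card ι * termProb (Fintype.card μ) (2 * t) t)
    (hι' : Fintype.card ι * termProb (Fintype.card μ) (2 * t) t ≤ 1) :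
    ((Fintype.card μ).choose (2 * t) / 45 : ℝ) ≤
      𝔼 T : ι → Term μ t, 𝔼 v : ι → μ, (#(criticalSets (2 * t) (fun i => (T i).1) v) : ℝ) := by
  have : Nonempty μ := Fintype.card_pos_iff.1 (by lia)
  have hexpect := expect_expect_card_criticalSets (ι := ι) (μ := μ) (k := 2 * t - 1) (t := t)
    (by lia)
  rw [show 2 * t - 1 + 1 = 2 * t by lia, hm] at hexpect
  rw [hm] at hι hι' ⊢
  have hι_pos : 1 ≤ Fintype.card ι := by
    rw [Nat.one_le_iff_ne_zero]
    rintro h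
    norm_num [h] at hι
  have hfew : (1 / 3 : ℝ) ≤ (1 - termProb (6 * t) (2 * t) t) ^ (Fintype.card ι - 1) := by
    refine one_third_le_one_sub_pow (termProb_le_half (by lia) ht) ?_
    rwa [Nat.cast_sub hι_pos, Nat.cast_one, sub_add_cancel]
  have hfresh : (2 / 3 : ℝ) ≤ 1 - (2 * t - 1 : ℕ) / (6 * t : ℕ) := by
    have hsize : ((2 * t - 1 : ℕ) : ℝ) ≤ 1 / 3 * (6 * t : ℕ) := by
      rw [one_div, le_inv_mul_iff₀ three_pos]
      exact_mod_cast (by lia : 3 * (2 * t - 1) ≤ 6 * t)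
    have := div_le_of_le_mul₀ (Nat.cast_nonneg _) (by norm_num) hsize
    linarith
  have hlayer : (2 * (6 * t).choose (2 * t) : ℝ) ≤ 5 * (6 * t).choose (2 * t - 1) := by
    exact_mod_cast two_mul_choose_le_five_mul_choose ht
  have hterm : (1 / 4 : ℝ) ≤ Fintype.card ι * termProb (6 * t) (2 * t - 1) t := by
    rw [← two_mul_termProb_two_mul_sub_one ht] at hι
    linarith
  calc ((6 * t).choose (2 * t) / 45 : ℝ)
      = 2 * (6 * t).choose (2 * t) / 5 * (1 / 4 * (2 / 3 * (1 / 3))) := by ring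
    _ ≤ (6 * t).choose (2 * t - 1) * (Fintype.card ι * termProb (6 * t) (2 * t - 1) t *
        ((1 - (2 * t - 1 : ℕ) / (6 * t : ℕ)) *
          (1 - termProb (6 * t) (2 * t) t) ^ (Fintype.card ι - 1))) := by
        gcongr
        linarith
    _ = _ := by rw [hexpect]; ring

open Classical in
theorem card_div_le_card_filter_criticalSets (ht : 1 ≤ t) (hm : Fintype.card μ = 6 * t)
    (hι : 1 / 2 ≤ Fintype.card ι * termProb (Fintype.card μ) (2 * t) t)
    (hι' : Fintype.card ι * termProb (Fintype.card μ) (2 * t) t ≤ 1) :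
    (Fintype.card ((ι → Term μ t) × (ι → μ)) / 36 : ℝ) ≤
      #{p : (ι → Term μ t) × (ι → μ) | (Fintype.card μ).choose (2 * t) ≤
        144 * #(criticalSets (2 * t) (fun i => (p.1 i).1) p.2)} := by
  set W : ℕ := (Fintype.card μ).choose (2 * t)
  have hW : (0 : ℝ) < W := by exact_mod_cast Nat.choose_pos (by lia)
  have hmax (p : (ι → Term μ t) × (ι → μ)) :
      (#(criticalSets (2 * t) (fun i => (p.1 i).1) p.2) : ℝ) ≤ W / 2 := by
    obtain ⟨k, hk⟩ : ∃ k, 2 * t = k + 1 := ⟨2 * t - 1, by lia⟩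
    have hle := card_criticalSets_le (k := k) (fun i => (p.1 i).1) p.2
    rw [le_div_iff₀ two_pos, mul_comm, hk]
    simp only [W, hk]
    exact_mod_cast (Nat.mul_le_mul_left 2 hle).trans (two_mul_choose_le_choose_succ (by lia))
  have hmean := choose_div_le_expect_expect_card_criticalSets ht hm hι hι'
  rw [← expect_product', univ_product_univ] at hmean
  have hmarkov := hmean.trans (expect_le_mul_card_filter_add hmax (c := W / 144) (by positivity))
  simp only [div_le_iff₀' (show (0 : ℝ) < 144 by norm_num)] at hmarkov
  have hfrac : W * (1 / 36 : ℝ) ≤ W * (#{p : (ι → Term μ t) × (ι → μ) | (W : ℝ) ≤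
      144 * #(criticalSets (2 * t) (fun i => (p.1 i).1) p.2)} /
        Fintype.card ((ι → Term μ t) × (ι → μ))) := by
    linarith
  obtain hempty | hnonempty := isEmpty_or_nonempty ((ι → Term μ t) × (ι → μ))
  · simp
  have hcard : (0 : ℝ) < Fintype.card ((ι → Term μ t) × (ι → μ)) := by
    exact_mod_cast Fintype.card_pos
  have := le_of_mul_le_mul_left hfrac hW
  rw [le_div_iff₀ hcard, one_div_mul_eq_div] at this
  exact_mod_cast this

end RandomCriticalSets

/-! ### The lower bound -/

section LowerBound

theorem mul_le_three_pow {t : ℕ} (ht : 5 ≤ t) : 24 * t ≤ 3 ^ t := by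
  induction t, ht using Nat.le_induction with
  | base => norm_num
  | succ t _ ih => lia

theorem one_add_four_mul_termProb_pow_le {m t q : ℕ} (ht : 5 ≤ t) (hm : 6 * t ≤ m)
    (hq : q ≤ 6 * t) : (1 + 4 * termProb m (2 * t) t) ^ q ≤ 3 := by
  have hp := termProb_nonneg m (2 * t) t
  have hqp : q * (4 * termProb m (2 * t) t) ≤ 1 :=
    calc q * (4 * termProb m (2 * t) t)
        ≤ (6 * t : ℕ) * (4 * termProb m (2 * t) t) := by gcongr
      _ = (24 * t : ℕ) * termProb m (2 * t) t := by push_cast; ring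
      _ ≤ (3 : ℕ) ^ t * termProb m (2 * t) t := by
          gcongr
          exact_mod_cast mul_le_three_pow ht
      _ ≤ 1 := pow_mul_termProb_le_one (by lia) t
  calc (1 + 4 * termProb m (2 * t) t) ^ q
      ≤ Real.exp (4 * termProb m (2 * t) t) ^ q := by
        gcongr
        rw [add_comm]
        exact Real.add_one_le_exp _
    _ = Real.exp (q * (4 * termProb m (2 * t) t)) := (Real.exp_nat_mul _ _).symm
    _ ≤ Real.exp 1 := Real.exp_le_exp.2 hqp
    _ ≤ 3 := Real.exp_one_lt_three.le

variable {n : ℕ} {μ φ ι : Type*} [Fintype μ] [DecidableEq μ] [Fintype ι] [DecidableEq ι]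
  {L : Layout μ φ n} {t q r : ℕ} {A : NonadaptiveAlg n}

/-- The parameters of the functions given to the tester, apart from the signs: the terms and, for
each term, the variable of its literal. -/
abbrev Draw (ι μ : Type*) (t : ℕ) : Type _ := (ι → Term μ t) × (ι → μ)

/-- The functions on which a tester must say "yes", truncated at the level `2 * t`. -/
noncomputable def yesInstance (L : Layout μ φ n) (i : Draw ι μ t × (ι → Bool)) : Cube n → Bool :=
  constantOnTerms L (2 * t) univ (fun j => (i.1.1 j).1) i.2

/-- The functions most of which are far from unate, truncated at the level `2 * t`. -/
noncomputable def noInstance (L : Layout μ φ n) (i : Draw ι μ t × (ι → Bool)) : Cube n → Bool :=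
  literalOnTerms L (2 * t) univ (fun j => (i.1.1 j).1) i.1.2 i.2

theorem expect_expect_expectedPayoff_separationPayoff_le_div (ht : 5 ≤ t)
    (hm : Fintype.card μ = 6 * t)
    (hι : Fintype.card ι * termProb (Fintype.card μ) (2 * t) t ≤ 1) (hq : q ≤ 6 * t)
    (hr : q * Fintype.card μ ≤ 2 ^ r) (hA : A.MakesAtMost q) (β : ι → Bool) :
    𝔼 T : ι → Term μ t, 𝔼 v : ι → μ,
        expectedPayoff (constantOnTerms L (2 * t) univ (fun i => (T i).1) β)
          (separationPayoff L (2 * t) (fun i => (T i).1) v) A [] ≤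
      q * (2 * r + 1) / (2 * t) := by
  refine (expect_expect_expectedPayoff_separationPayoff_le (by lia) (by lia) le_rfl hr hA).trans ?_
  rw [hm] at hι ⊢
  have hp := termProb_nonneg (6 * t) (2 * t) t
  calc Fintype.card ι * ((1 + 4 * termProb (6 * t) (2 * t) t) ^ q *
        (termProb (6 * t) (2 * t) t * (q * (2 * r + 1)) / (6 * t : ℕ)))
      = Fintype.card ι * termProb (6 * t) (2 * t) t *
          (1 + 4 * termProb (6 * t) (2 * t) t) ^ q * (q * (2 * r + 1) / (6 * t : ℕ)) := by ring
    _ ≤ 1 * 3 * (q * (2 * r + 1) / (6 * t : ℕ)) := by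
        gcongr
        exact one_add_four_mul_termProb_pow_le ht le_rfl hq
    _ = q * (2 * r + 1) / (2 * t) := by
        push_cast
        field_simp
        ring

theorem sum_acceptProb_constantOnTerms_le_sum_add (ht : 5 ≤ t) (hm : Fintype.card μ = 6 * t)
    (hι : Fintype.card ι * termProb (Fintype.card μ) (2 * t) t ≤ 1) (hq : q ≤ 6 * t)
    (hr : q * Fintype.card μ ≤ 2 ^ r) (hA : A.MakesAtMost q)
    (s : Finset (Draw ι μ t)) :
    ∑ i ∈ s ×ˢ univ, acceptProb (yesInstance L i) A ≤
      ∑ i ∈ s ×ˢ univ, acceptProb (noInstance L i) A +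
        Fintype.card (Draw ι μ t) * Fintype.card (ι → Bool) * (q * (2 * r + 1) / (2 * t)) := by
  let loss (p : Draw ι μ t) (β : ι → Bool) : ℝ :=
    expectedPayoff (constantOnTerms L (2 * t) univ (fun j => (p.1 j).1) β)
      (separationPayoff L (2 * t) (fun j => (p.1 j).1) p.2) A []
  have hloss_nonneg (p β) : 0 ≤ loss p β := expectedPayoff_nonneg separationPayoff_nonneg A []
  have hloss (β : ι → Bool) : ∑ p, loss p β ≤
      Fintype.card (Draw ι μ t) * (q * (2 * r + 1) / (2 * t)) := by
    rw [← Fintype.card_mul_expect, ← univ_product_univ, expect_product]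
    gcongr
    exact expect_expect_expectedPayoff_separationPayoff_le_div ht hm hι hq hr hA β
  rw [sum_product, sum_product]
  have hcoupling : ∑ p ∈ s, ∑ β, acceptProb (yesInstance L (p, β)) A ≤
      ∑ p ∈ s, (∑ β, acceptProb (noInstance L (p, β)) A + ∑ β, loss p β) :=
    sum_le_sum fun p _ => sum_acceptProb_constantOnTerms_le (L := L) (k := 2 * t) (R := univ)
      (T := fun j => (p.1 j).1) (v := p.2) A
  have htotal : ∑ p ∈ s, ∑ β, loss p β ≤ Fintype.card (Draw ι μ t) * Fintype.card (ι → Bool) *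
      (q * (2 * r + 1) / (2 * t)) :=
    calc ∑ p ∈ s, ∑ β, loss p β
        ≤ ∑ p, ∑ β, loss p β := sum_le_sum_of_subset_of_nonneg (subset_univ s) fun p _ _ =>
          sum_nonneg fun _ _ => hloss_nonneg p _
      _ = ∑ β, ∑ p, loss p β := sum_comm
      _ ≤ ∑ _ : ι → Bool, Fintype.card (Draw ι μ t) * (q * (2 * r + 1) / (2 * t) : ℝ) :=
          sum_le_sum fun β _ => hloss β
      _ = _ := by rw [sum_const, card_univ, nsmul_eq_mul]; ring
  rw [sum_add_distrib] at hcoupling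
  exact hcoupling.trans (add_le_add le_rfl htotal)

open Classical in
theorem card_draw_div_le_card_filter (ht : 1 ≤ t) (hm : Fintype.card μ = 6 * t)
    (hι : 1 / 2 ≤ Fintype.card ι * termProb (Fintype.card μ) (2 * t) t)
    (hι' : Fintype.card ι * termProb (Fintype.card μ) (2 * t) t ≤ 1) (L : Layout μ φ n) :
    (Fintype.card (Draw ι μ t) / 36 : ℝ) ≤
      #{p : Draw ι μ t | ∀ β, 1 / 3456 ≤ relDistTo (noInstance L (p, β)) (unate n)} := by
  refine (card_div_le_card_filter_criticalSets ht hm hι hι').trans (Nat.cast_le.2 ?_)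
  exact card_le_card (monotone_filter_right _ fun p _ hp β =>
    le_relDistTo_unate (T := fun j => (p.1 j).1) (by lia) hp)

theorem card_le_of_isTesterUnderPromise [Fintype φ] (ht : 5 ≤ t)
    (hm : Fintype.card μ = 6 * t)
    (hι : Fintype.card ι * termProb (Fintype.card μ) (2 * t) t ≤ 1) (hq : q ≤ 6 * t)
    (hr : q * Fintype.card μ ≤ 2 ^ r) {𝓓 : Set (Cube n → Bool)}
    (h𝓓 : ∀ f : Cube n → Bool,
      (Fintype.card μ).choose (2 * t) * 2 ^ Fintype.card φ ≤ #(satSet f) →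
      #(satSet f) ≤ 6 * ((Fintype.card μ).choose (2 * t) * 2 ^ Fintype.card φ) → f ∈ 𝓓)
    {ε : ℝ} {T : RandomizedAlg n} (hT : IsTesterUnderPromise T ε (unate n) 𝓓)
    (hTq : T.MakesAtMost q) {s : Finset (Draw ι μ t)}
    (hs : ∀ p ∈ s, ∀ β, ε ≤ relDistTo (noInstance L (p, β)) (unate n)) :
    (#s : ℝ) ≤ 3 * (Fintype.card (Draw ι μ t) * (q * (2 * r + 1) / (2 * t))) := by
  have hyes (i : Draw ι μ t × (ι → Bool)) : yesInstance L i ∈ 𝓓 :=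
    h𝓓 _ choose_mul_le_card_satSet (card_satSet_le (by lia))
  have hno (i : Draw ι μ t × (ι → Bool)) : noInstance L i ∈ 𝓓 :=
    h𝓓 _ choose_mul_le_card_satSet (card_satSet_le (by lia))
  have htester : (#(s ×ˢ univ) : ℝ) ≤ 3 * (Fintype.card (Draw ι μ t) * Fintype.card (ι → Bool) *
      (q * (2 * r + 1) / (2 * t))) :=
    card_le_three_mul_of_acceptProb_le (Y := yesInstance L) (Z := noInstance L)
      (fun _ => satSet_truncatedTalagrand_nonempty) (fun _ => satSet_truncatedTalagrand_nonempty)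
      (fun i _ => (hT _ _ (hyes i)).1 (truncatedTalagrand_mem_unate i.2))
      (fun i hi => (hT _ _ (hno i)).2 (hs i.1 (mem_product.1 hi).1 i.2)) (by positivity)
      fun A hA => sum_acceptProb_constantOnTerms_le_sum_add ht hm hι hq hr (hTq A hA) s
  have hsigns : (0 : ℝ) < Fintype.card (ι → Bool) := by exact_mod_cast Fintype.card_pos
  rw [card_product, card_univ, Nat.cast_mul] at htester
  refine le_of_mul_le_mul_right (htester.trans_eq ?_) hsigns
  ring

end LowerBound

theorem le_mul_of_isTesterUnderPromise {n : ℕ} {μ φ : Type*} [Fintype μ] [Fintype φ]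
    (L : Layout μ φ n) {t q r : ℕ} (ht : 5 ≤ t)
    (hm : Fintype.card μ = 6 * t) (hq : q ≤ 6 * t) (hr : q * Fintype.card μ ≤ 2 ^ r)
    {𝓓 : Set (Cube n → Bool)}
    (h𝓓 : ∀ f : Cube n → Bool,
      (Fintype.card μ).choose (2 * t) * 2 ^ Fintype.card φ ≤ #(satSet f) →
      #(satSet f) ≤ 6 * ((Fintype.card μ).choose (2 * t) * 2 ^ Fintype.card φ) → f ∈ 𝓓)
    {T : RandomizedAlg n} (hT : IsTesterUnderPromise T (1 / 3456) (unate n) 𝓓)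
    (hTq : T.MakesAtMost q) : (t : ℝ) ≤ 54 * (q * (2 * r + 1)) := by
  classical
  obtain ⟨M, hM, hM'⟩ := exists_half_le_nat_mul_le_one
    (termProb_pos (m := Fintype.card μ) (k := 2 * t) (t := t) (by lia) (by lia))
    (termProb_le_half (by lia) (by lia))
  rw [← Fintype.card_fin M] at hM hM'
  have hfar := (card_draw_div_le_card_filter (by lia) hm hM hM' L).trans
    (card_le_of_isTesterUnderPromise ht hm hM' hq hr h𝓓 hT hTq
      fun p hp => (mem_filter.1 hp).2)
  have hdraw : (0 : ℝ) < Fintype.card (Draw (Fin M) μ t) := by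
    have : Nonempty μ := Fintype.card_pos_iff.1 (by lia)
    have : Nonempty (Term μ t) := nonempty_term (by lia)
    exact_mod_cast Fintype.card_pos
  have hbound : 1 / 36 ≤ 3 * (q * (2 * r + 1) / (2 * t) : ℝ) :=
    le_of_mul_le_mul_left (by linarith) hdraw
  have ht_pos : (0 : ℝ) < 2 * t := by positivity
  rw [← mul_div_assoc, le_div_iff₀ ht_pos] at hbound
  linarith

theorem exists_layout {n ℓ t : ℕ} (ht : 6 * t ≤ ℓ) (hn : 6 * t + 2 + ℓ ≤ n) :
    ∃ b, Nonempty (Layout (Fin (6 * t)) (Fin b) n) ∧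
      2 ^ ℓ ≤ (6 * t).choose (2 * t) * 2 ^ b ∧ (6 * t).choose (2 * t) * 2 ^ b ≤ 2 ^ (ℓ + 1) := by
  set c := (6 * t).choose (2 * t)
  have hc_ne : c ≠ 0 := (Nat.choose_pos (by lia)).ne'
  have hc_log : Nat.log 2 c ≤ ℓ := by
    have hle := Nat.log_mono_right (b := 2) (Nat.choose_le_two_pow (6 * t) (2 * t))
    rw [Nat.log_pow Nat.one_lt_two] at hle
    lia
  refine ⟨ℓ - Nat.log 2 c, ?_, ?_, ?_⟩
  · refine Function.Embedding.nonempty_of_card_le ?_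
    simp only [Fintype.card_sum, Fintype.card_fin, Fintype.card_bool]
    lia
  · calc 2 ^ ℓ = 2 ^ Nat.log 2 c * 2 ^ (ℓ - Nat.log 2 c) := by
          rw [← pow_add, Nat.add_sub_cancel' hc_log]
      _ ≤ c * 2 ^ (ℓ - Nat.log 2 c) := Nat.mul_le_mul_right _ (Nat.pow_log_le_self _ hc_ne)
  · calc c * 2 ^ (ℓ - Nat.log 2 c) ≤ 2 ^ (Nat.log 2 c + 1) * 2 ^ (ℓ - Nat.log 2 c) :=
          Nat.mul_le_mul_right _ (Nat.lt_pow_succ_log_self Nat.one_lt_two _).le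
      _ = 2 ^ (ℓ + 1) := by rw [← pow_add]; congr 1; lia

theorem log_le_of_le_two_pow {x : ℝ} {a : ℕ} (hx : 0 < x) (h : x ≤ 2 ^ a) : Real.log x ≤ a := by
  have hlog := Real.log_le_log hx h
  rw [Real.log_pow] at hlog
  exact hlog.trans (mul_le_of_le_one_right (Nat.cast_nonneg a)
    (Real.log_two_lt_d9.le.trans (by norm_num)))

theorem half_le_log_of_two_pow_le {x : ℝ} {a : ℕ} (h : 2 ^ a ≤ x) : (a : ℝ) / 2 ≤ Real.log x := by
  have hlog := Real.log_le_log (by positivity) h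
  rw [Real.log_pow] at hlog
  refine le_trans ?_ hlog
  rw [div_eq_mul_inv]
  gcongr
  exact le_trans (by norm_num) Real.log_two_gt_d9.le

theorem one_le_log_log_of_two_pow_le {x : ℝ} {ℓ : ℕ} (hℓ : 6 ≤ ℓ) (h : 2 ^ ℓ ≤ x) :
    1 ≤ Real.log (Real.log x) := by
  have hexp : Real.exp 1 ≤ Real.log x :=
    calc Real.exp 1 ≤ 3 := Real.exp_one_lt_three.le
      _ ≤ (ℓ : ℝ) / 2 := by
        rw [le_div_iff₀ two_pos]
        exact_mod_cast hℓ
      _ ≤ Real.log x := half_le_log_of_two_pow_le h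
  exact (Real.le_log_iff_exp_le ((Real.exp_pos 1).trans_le hexp)).2 hexp

theorem log_le_mul_log_log_of_two_pow_le {x : ℝ} {ℓ : ℕ} (hℓ : 6 ≤ ℓ) (h : 2 ^ ℓ ≤ x) :
    (Nat.log 2 ℓ : ℝ) ≤ 4 * Real.log (Real.log x) := by
  have hℓ_pos : (0 : ℝ) < ℓ := by exact_mod_cast (by lia : 0 < ℓ)
  have hpow : (2 : ℝ) ^ Nat.log 2 ℓ ≤ ℓ := by exact_mod_cast Nat.pow_log_le_self 2 (by lia)
  have hhalf : Real.log ℓ - Real.log 2 ≤ Real.log (Real.log x) := by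
    rw [← Real.log_div hℓ_pos.ne' two_ne_zero]
    exact Real.log_le_log (by positivity) (half_le_log_of_two_pow_le h)
  linarith [half_le_log_of_two_pow_le hpow, one_le_log_log_of_two_pow_le hℓ h,
    Real.log_two_lt_d9]

theorem mem_sizeWithinFactor {n N ℓ W : ℕ} (hℓ : 2 ^ ℓ ≤ N) (hℓ' : N < 2 ^ (ℓ + 1))
    (hW : 2 ^ ℓ ≤ W) (hW' : W ≤ 2 ^ (ℓ + 1)) {f : Cube n → Bool} (hf : W ≤ #(satSet f))
    (hf' : #(satSet f) ≤ 6 * W) : f ∈ sizeWithinFactor n 12 N := by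
  rw [pow_succ] at hℓ' hW'
  rw [sizeWithinFactor, Set.mem_ofPred_eq, div_le_iff₀ (by norm_num)]
  constructor
  · exact_mod_cast (by lia : N ≤ #(satSet f) * 12)
  · exact_mod_cast (by lia : #(satSet f) ≤ 12 * N)

theorem le_mul_log_log_of_isTesterUnderPromise {n N ℓ t q : ℕ} (hℓ : 2 ^ ℓ ≤ N)
    (hℓ' : N < 2 ^ (ℓ + 1)) (ht : 5 ≤ t) (htℓ : 6 * t ≤ ℓ) (hn : 6 * t + 2 + ℓ ≤ n)
    {T : RandomizedAlg n}
    (hT : IsTesterUnderPromise T (1 / 3456) (unate n) (sizeWithinFactor n 12 N))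
    (hTq : T.MakesAtMost q) : (t : ℝ) ≤ 1134 * (q * Real.log (Real.log N)) := by
  have hN : (2 : ℝ) ^ ℓ ≤ N := by exact_mod_cast hℓ
  have hloglog := one_le_log_log_of_two_pow_le (by lia) hN
  have hlog := log_le_mul_log_log_of_two_pow_le (by lia) hN
  obtain hq | hq := le_or_gt q (6 * t)
  · obtain ⟨b, ⟨L⟩, hW, hW'⟩ := exists_layout htℓ hn
    have hr : q * (6 * t) ≤ 2 ^ (2 * (Nat.log 2 ℓ + 1)) := by
      have hℓ_lt : ℓ < 2 ^ (Nat.log 2 ℓ + 1) := Nat.lt_pow_succ_log_self Nat.one_lt_two _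
      rw [two_mul, pow_add]
      exact Nat.mul_le_mul (by lia) (by lia)
    have hmain := le_mul_of_isTesterUnderPromise L ht (by simp) hq (by simpa using hr)
      (fun f hf hf' => mem_sizeWithinFactor hℓ hℓ' hW hW' (by simpa using hf) (by simpa using hf'))
      hT hTq
    calc (t : ℝ) ≤ 54 * (q * (2 * (2 * (Nat.log 2 ℓ + 1) : ℕ) + 1)) := hmain
      _ ≤ 54 * (q * (21 * Real.log (Real.log N))) := by
        gcongr
        push_cast
        linarith
      _ = 1134 * (q * Real.log (Real.log N)) := by ring
  · have htq : (t : ℝ) ≤ q := by exact_mod_cast (by lia : t ≤ q)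
    nlinarith

theorem min_log_le_of_two_pow_le {n N ℓ : ℕ} (hℓ : 2 ^ ℓ ≤ N) (hℓ' : N < 2 ^ (ℓ + 1))
    (hn : ℓ + 2 ≤ n) :
    min (Real.log N) (Real.log (2 ^ n / N)) ≤ (min ℓ (n - 2 - ℓ) + 2 : ℕ) := by
  have hN : (0 : ℝ) < N := by exact_mod_cast (by positivity : 0 < 2 ^ ℓ).trans_le hℓ
  have hlog : Real.log N ≤ (ℓ + 1 : ℕ) := log_le_of_le_two_pow hN (by exact_mod_cast hℓ'.le)
  have hdiv : Real.log (2 ^ n / N) ≤ (n - ℓ : ℕ) := by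
    refine log_le_of_le_two_pow (by positivity) ?_
    rw [div_le_iff₀ hN]
    norm_cast
    calc 2 ^ n = 2 ^ (n - ℓ) * 2 ^ ℓ := by rw [← pow_add, Nat.sub_add_cancel (by lia)]
      _ ≤ 2 ^ (n - ℓ) * N := Nat.mul_le_mul_left _ hℓ
  rw [← Nat.add_min_add_right, Nat.cast_min]
  exact min_le_min (hlog.trans (by gcongr; lia)) (hdiv.trans (by gcongr; lia))

theorem rpow_one_sub_le_two_pow_div {α : ℝ} {n N : ℕ} (hN : 0 < N) (hα : α ≤ 1)
    (h : (N : ℝ) ≤ 2 ^ (α * n)) : (N : ℝ) ^ (1 - α) ≤ 2 ^ n / N := by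
  have hN' : (0 : ℝ) < N := by exact_mod_cast hN
  have hN_le : (N : ℝ) ≤ 2 ^ (n : ℝ) := h.trans (Real.rpow_le_rpow_of_exponent_le one_le_two
    (mul_le_of_le_one_left (Nat.cast_nonneg n) hα))
  rw [le_div_iff₀ hN', ← Real.rpow_natCast]
  calc (N : ℝ) ^ (1 - α) * N ≤ (2 ^ (n : ℝ)) ^ (1 - α) * 2 ^ (α * n) := by
        gcongr
    _ = 2 ^ (n : ℝ) := by
        rw [← Real.rpow_mul zero_le_two, ← Real.rpow_add two_pos]
        ring_nf

theorem min_one_mul_log_le_min_log {α : ℝ} {n N : ℕ} (hN : 0 < N) (hα : α ≤ 1)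
    (h : (N : ℝ) ≤ 2 ^ (α * n)) :
    min 1 (1 - α) * Real.log N ≤ min (Real.log N) (Real.log (2 ^ n / N)) := by
  have hN' : (0 : ℝ) < N := by exact_mod_cast hN
  rw [min_mul_of_nonneg _ _ (Real.log_natCast_nonneg N), one_mul, ← Real.log_rpow hN']
  exact min_le_min_left _ (Real.log_le_log (by positivity) (rpow_one_sub_le_two_pow_div hN hα h))

theorem eventually_le_two_pow_div {α : ℝ} (hα : α < 1) (a : ℝ) :
    ∀ᶠ N : ℕ in Filter.atTop, ∀ n : ℕ, (N : ℝ) ≤ 2 ^ (α * n) → a ≤ 2 ^ n / N := by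
  have htendsto := (tendsto_rpow_atTop (sub_pos.2 hα)).comp tendsto_natCast_atTop_atTop
  filter_upwards [htendsto.eventually_ge_atTop a, Filter.eventually_gt_atTop 0] with N ha hN n h
  exact ha.trans (rpow_one_sub_le_two_pow_div hN hα.le h)

end RelativeError

open RelativeError in
theorem mainTheorem3_general :
    ∃ c : ℝ, 0 < c ∧ ∃ N₀ : ℕ, ∀ n N : ℕ, N₀ ≤ N → (N₀ : ℝ) ≤ 2 ^ n / N →
      ∀ (T : RandomizedAlg n) (q : ℕ),
        IsTesterUnderPromise T (1 / 3456) (unate n) (sizeWithinFactor n 12 N) →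
        T.MakesAtMost q →
          c * min (Real.log N) (Real.log (2 ^ n / N)) / Real.log (Real.log N) ≤ q := by
  refine ⟨1 / 9072, by norm_num, 2 ^ 32, fun n N hN hnN T q hT hTq => ?_⟩
  have hN_pos : 0 < N := (by norm_num : 0 < 2 ^ 32).trans_le hN
  have hℓ : 2 ^ Nat.log 2 N ≤ N := Nat.pow_log_le_self 2 hN_pos.ne'
  have hℓ' : N < 2 ^ (Nat.log 2 N + 1) := Nat.lt_pow_succ_log_self Nat.one_lt_two N
  have hℓ_ge : 32 ≤ Nat.log 2 N := Nat.le_log_of_pow_le Nat.one_lt_two hN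
  have hn : 32 + Nat.log 2 N ≤ n := by
    rw [le_div_iff₀ (by exact_mod_cast hN_pos)] at hnN
    rw [← Nat.pow_le_pow_iff_right Nat.one_lt_two, pow_add]
    exact (Nat.mul_le_mul_left _ hℓ).trans (by exact_mod_cast hnN)
  have hmin := min_log_le_of_two_pow_le (n := n) hℓ hℓ' (by lia)
  obtain ⟨t, ht⟩ : ∃ t, t = min (Nat.log 2 N) (n - 2 - Nat.log 2 N) / 6 := ⟨_, rfl⟩
  have hmin_le : min (Real.log N) (Real.log (2 ^ n / N)) ≤ 8 * t :=
    hmin.trans (by exact_mod_cast (by lia))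
  have ht_le := le_mul_log_log_of_isTesterUnderPromise (t := t) hℓ hℓ' (by lia) (by lia) (by lia)
    hT hTq
  have hloglog : 1 ≤ Real.log (Real.log N) :=
    one_le_log_log_of_two_pow_le (ℓ := Nat.log 2 N) (by lia) (by exact_mod_cast hℓ)
  rw [div_le_iff₀ (by linarith)]
  linarith

theorem mainTheorem3 (α₀ : ℝ) (hα₀ : α₀ < 1) :
    ∃ ε₀ : ℝ, 0 < ε₀ ∧ ∃ C : ℝ, 1 ≤ C ∧ ∃ c : ℝ, 0 < c ∧ ∃ k N₀ : ℕ,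
      ∀ n N : ℕ, N₀ ≤ N → (N : ℝ) ≤ (2 : ℝ) ^ (α₀ * (n : ℝ)) →
        ∀ (T : RelativeError.RandomizedAlg n) (q : ℕ),
          RelativeError.IsTesterUnderPromise T ε₀ (RelativeError.unate n)
            (RelativeError.sizeWithinFactor n C N) →
          RelativeError.RandomizedAlg.MakesAtMost T q →
            c * Real.log N / Real.log (Real.log N) ^ k ≤ (q : ℝ) := by
  obtain ⟨c, hc, N₀, hbound⟩ := mainTheorem3_general
  obtain ⟨N₁, hN₁⟩ :=
    Filter.eventually_atTop.1 (RelativeError.eventually_le_two_pow_div hα₀ N₀)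
  refine ⟨1 / 3456, by norm_num, 12, by norm_num, c * min 1 (1 - α₀),
    mul_pos hc (lt_min one_pos (sub_pos.2 hα₀)), 1, max (max N₀ N₁) (2 ^ 6),
    fun n N hN hnN T q hT hTq => ?_⟩
  have hloglog : 1 ≤ Real.log (Real.log N) :=
    RelativeError.one_le_log_log_of_two_pow_le le_rfl (by exact_mod_cast (by lia : 2 ^ 6 ≤ N))
  refine le_trans ?_ (hbound n N (by lia) (hN₁ N (by lia) n hnN) T q hT hTq)
  rw [pow_one, mul_assoc]
  gcongr
  exact RelativeError.min_one_mul_log_le_min_log (by lia) hα₀.le hnN
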